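/- Let $0<r<R$ and let $\mathcal T\subset\mathbb R^3$ be the ring torus $T(x,y,z)=0$, where $$T=z^4+p_2z^2+p_0,\quad p_2=2(R^2-r^2+x^2+y^2),\quad p_0=(R^2+2Rr+r^2-x^2-y^2)(R^2-2Rr+r^2-x^2-y^2).$$ Let $Q\in\mathbb R[x,y,z]$ define a real cone $\mathcal Q=\{Q=0\}\subset\mathbb R^3$ with vertex $P$; that is, $Q$ is a nondegenerate quadratic form in the coordinates centred at $P$, and $\mathcal Q$ contains a real point other than $P$. If $P\in\mathcal T$, then $P$ is a singular point of the real intersection curve $\mathcal C_{\mathbb R}=\mathcal T\cap\mathcal Q$. Here a point $P\in\mathcal C_{\mathbb R}$ is called singular if the Jacobian matrix of a system of generators of the ideal $I(\mathcal C_{\mathbb R})=\{f\in\mathbb R[x,y,z] : f|_{\mathcal C_{\mathbb R}}=0\}$ has rank $0$ or $1$ at $P$ (this does not depend on the choice of generators). -/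

import Mathlib

noncomputable section

namespace TorusQuadric

open MvPolynomial

/-- `p₂(x,y) = 2(R² - r² + x² + y²)`, as a polynomial in `x = X 0`, `y = X 1`, `z = X 2`. -/
def p2 (R r : ℝ) : MvPolynomial (Fin 3) ℝ :=
  C 2 * (C (R ^ 2 - r ^ 2) + X 0 ^ 2 + X 1 ^ 2)

/-- `p₀(x,y) = (R² + 2Rr + r² - x² - y²)(R² - 2Rr + r² - x² - y²)`. -/
def p0 (R r : ℝ) : MvPolynomial (Fin 3) ℝ :=
  (C (R ^ 2 + 2 * R * r + r ^ 2) - X 0 ^ 2 - X 1 ^ 2) *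
    (C (R ^ 2 - 2 * R * r + r ^ 2) - X 0 ^ 2 - X 1 ^ 2)

/-- The torus polynomial `T = z⁴ + p₂(x,y) z² + p₀(x,y)`: the torus centred at the origin with
axis of revolution the `z`-axis, major radius `R` and minor radius `r`. -/
def torusPoly (R r : ℝ) : MvPolynomial (Fin 3) ℝ :=
  X 2 ^ 4 + p2 R r * X 2 ^ 2 + p0 R r

/-- The set of real points in `ℝ³` of the surface defined by a polynomial. -/
def realSurface (F : MvPolynomial (Fin 3) ℝ) : Set (Fin 3 → ℝ) :=
  {p | eval p F = 0}

/-- The ring torus `𝒯 ⊆ ℝ³` (when `0 < r < R`). -/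
def torus (R r : ℝ) : Set (Fin 3 → ℝ) := realSurface (torusPoly R r)

/-- The real intersection curve `𝒯 ∩ 𝒬` of the torus and the surface `Q = 0`. -/
def intersectionCurve (R r : ℝ) (Q : MvPolynomial (Fin 3) ℝ) : Set (Fin 3 → ℝ) :=
  torus R r ∩ realSurface Q

/-- `Q = 0` is a real (quadratic, nondegenerate) cone with vertex `P`: `Q` is a nondegenerate
quadratic form in the coordinates centred at `P`, and the cone has a real point other than `P`.
Nondegeneracy excludes double planes and pairs of planes (real or complex conjugate); the last
clause excludes the imaginary cones, whose only real point is the vertex. -/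
def IsRealCone (Q : MvPolynomial (Fin 3) ℝ) (P : Fin 3 → ℝ) : Prop :=
  (∃ M : Matrix (Fin 3) (Fin 3) ℝ, M.IsSymm ∧ M.det ≠ 0 ∧
    Q = ∑ i, ∑ j, C (M i j) * (X i - C (P i)) * (X j - C (P j))) ∧
  ∃ p ∈ realSurface Q, p ≠ P

/-- The Jacobian matrix of a finite family of polynomials, specialised at the point `P`. -/
def jacobianAt {m : ℕ} (g : Fin m → MvPolynomial (Fin 3) ℝ) (P : Fin 3 → ℝ) :
    Matrix (Fin m) (Fin 3) ℝ :=
  Matrix.of fun i j => eval P (pderiv j (g i))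

/-- `P` is a singular point of the real space curve `𝒞`: it lies on `𝒞`, and the Jacobian matrix
at `P` of a system of generators of `I(𝒞) = {f ∈ ℝ[x,y,z] | f vanishes on 𝒞}` has rank at most one.
(For `P ∈ 𝒞` the rank does not depend on the system of generators.) -/
def IsSingularPoint (𝒞 : Set (Fin 3 → ℝ)) (P : Fin 3 → ℝ) : Prop :=
  P ∈ 𝒞 ∧ ∃ (m : ℕ) (g : Fin m → MvPolynomial (Fin 3) ℝ),
    Ideal.span (Set.range g) = vanishingIdeal ℝ 𝒞 ∧ (jacobianAt g P).rank ≤ 1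

end TorusQuadric

end

/-! The heart of the matter is that every polynomial f vanishing on the curve has its gradient at P
proportional to ∇T(P) (`gradient_proportional_of_vanishing`). All rows of the Jacobian matrix are
then multiples of one vector.

Parametrize the lines of the cone by directions V(s), quadratic in s, whose coefficient vectors form
a basis of ℝ³. Writing T = u² - 4R²(x² + y²) with u = x² + y² + z² + R² - r², one gets T(P + τV) =
τG with G = c₁ + c₂τ + c₃τ² + c₄τ³, deg cᵢ ≤ 2i, c₁ = ∇T(P)·V, and c₄ = |V|⁴ free of real zeros.
Likewise f(P + τV) = τg, and the lowest coefficient of g is ∇f(P)·V. If c₁ divides this coefficient,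
the quotient is a constant by degree, and the gradients are proportional because V spans ℝ³.

For the divisibility (`coeff_zero_dvd`), a nonconstant irreducible factor of G with real zeros over
infinitely many s divides g. An irreducible G qualifies, since a real cubic has a real root.
Otherwise G has a factor linear in τ, and degree and parity counts settle everything except G = (aτ
- 1)(a'τ² + b'τ - c₁) with deg a = 2 and a quadratic factor of nonpositive discriminant.

In that case S = P + V/a moves on the torus (`torus_circle_discrim_pos`). Its meridian and longitude
angles are given by complex binary quadratic forms of definite modulus, so each is constant or takes
every value. If the meridian angle takes every value, some S lies at the height of P, on the
parallel mirrored in the core circle, and the discriminant there is positive. If the longitude does,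
some S lies opposite P, and the segment PS crosses the axis, where T > 0 although the discriminant
condition forces T ≤ 0. If both are constant, V stays on one line. -/

/-! ### Common zeros and growth of real polynomials -/

section
open Polynomial

/-- If p did not divide g, Gauss's lemma would make them coprime over the fraction field. Clearing
denominators in a Bézout relation gives a nonzero polynomial in s alone that vanishes at infinitely
many s. -/
theorem dvd_of_infinite_common_zeros {F : Type*} [Field F] {p g : F[X][X]} (hp : Irreducible p)
    (hd : p.natDegree ≠ 0)
    (hinf : {s : F | ∃ τ, evalEval s τ p = 0 ∧ evalEval s τ g = 0}.Infinite) : p ∣ g := by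
  by_contra hpg
  let _inst : NormalizedGCDMonoid F[X] := Classical.arbitrary _
  have hprim : p.IsPrimitive := hp.isPrimitive hd
  have hinj : Function.Injective (algebraMap F[X] (FractionRing F[X])) :=
    IsFractionRing.injective _ _
  have hirr : Irreducible (p.map (algebraMap F[X] (FractionRing F[X]))) :=
    hprim.irreducible_iff_irreducible_map_fraction_map.1 hp
  have hnd : ¬ p.map (algebraMap F[X] (FractionRing F[X])) ∣ g.map (algebraMap _ _) :=
    fun h => hpg (hprim.dvd_of_fraction_map_dvd_fraction_map h)
  obtain ⟨a, b, hab⟩ := hirr.coprime_iff_not_dvd.2 hnd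
  obtain ⟨da, hma, hda⟩ := IsLocalization.integerNormalization_spec (nonZeroDivisors F[X]) a
  obtain ⟨db, hmb, hdb⟩ := IsLocalization.integerNormalization_spec (nonZeroDivisors F[X]) b
  set A := IsLocalization.integerNormalization (nonZeroDivisors F[X]) a
  set B := IsLocalization.integerNormalization (nonZeroDivisors F[X]) b
  have key : C db * A * p + C da * B * g = C (da * db) := by
    apply Polynomial.map_injective _ hinj
    simp only [Polynomial.map_add, Polynomial.map_mul, map_C, hda, hdb, map_mul]
    have e1 : ∀ (d : F[X]) (q : (FractionRing F[X])[X]),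
        d • q = C (algebraMap F[X] (FractionRing F[X]) d) * q := by
      intro d q
      rw [← smul_eq_C_mul, algebraMap_smul]
    rw [e1, e1]
    linear_combination (C (algebraMap F[X] (FractionRing F[X]) da) *
      C (algebraMap F[X] (FractionRing F[X]) db)) * hab
  have hne : da * db ≠ 0 :=
    mul_ne_zero (nonZeroDivisors.ne_zero hma) (nonZeroDivisors.ne_zero hmb)
  apply hne
  apply Polynomial.eq_zero_of_infinite_isRoot
  refine hinf.mono ?_
  rintro s ⟨τ, h1, h2⟩
  have := congrArg (evalEval s τ) key
  simpa [evalEval_add, evalEval_mul, h1, h2, evalEval_C] using this.symm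

theorem exists_eval_eq_zero_of_odd_natDegree {p : ℝ[X]} (hp : Odd p.natDegree) :
    ∃ s, eval s p = 0 := by
  wlog hlc : 0 ≤ p.leadingCoeff generalizing p
  · obtain ⟨s, hs⟩ := this (p := -p) (by simpa using hp) (by simp; linarith)
    exact ⟨s, by simpa using hs⟩
  have hd : 0 < p.degree := natDegree_pos_iff_degree_pos.1 hp.pos
  have h1 := p.tendsto_atTop_of_leadingCoeff_nonneg hd hlc
  have h2 := (-(p.comp (-X))).tendsto_atTop_of_leadingCoeff_nonneg
    (natDegree_pos_iff_degree_pos.1 (by simpa [natDegree_comp] using hp.pos))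
    (by rw [leadingCoeff_neg, leadingCoeff_comp (by simp)]
        simpa [hp.neg_one_pow] using hlc)
  obtain ⟨s, hs⟩ := (h1.eventually_ge_atTop 0).exists
  obtain ⟨t, ht⟩ := (h2.eventually_ge_atTop 0).exists
  simp only [eval_neg, eval_comp, eval_X] at ht
  exact mem_range_of_exists_le_of_exists_ge p.continuous ⟨-t, by linarith⟩ ⟨s, hs⟩

theorem two_mul_natDegree_le_of_sq_le {p q : ℝ[X]} (h : ∀ s, eval s p ^ 2 ≤ eval s q) :
    2 * p.natDegree ≤ q.natDegree := by
  by_contra! hlt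
  have hd : q.natDegree < (p ^ 2).natDegree := by rw [natDegree_pow]; exact hlt
  have hp : p ≠ 0 := by rintro rfl; simp at hlt
  have h1 : (p ^ 2 - q).natDegree = (p ^ 2).natDegree := natDegree_sub_eq_left_of_natDegree_lt hd
  have h2 : (p ^ 2 - q).leadingCoeff = p.leadingCoeff ^ 2 := by
    rw [leadingCoeff_sub_of_degree_lt (degree_lt_degree hd), leadingCoeff_pow]
  have h3 := (p ^ 2 - q).tendsto_atTop_of_leadingCoeff_nonneg
    (natDegree_pos_iff_degree_pos.1 (by omega)) (by rw [h2]; positivity)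
  obtain ⟨s, hs⟩ := (h3.eventually_ge_atTop 1).exists
  have := h s
  simp only [eval_sub, eval_pow] at hs
  linarith

theorem dvd_of_dvd_of_natDegree_eq {F : Type*} [Field F] {p q : F[X]} (h : p ∣ q) (hq : q ≠ 0)
    (hd : p.natDegree = q.natDegree) : q ∣ p := by
  obtain ⟨u, rfl⟩ := h
  have hp : p ≠ 0 := left_ne_zero_of_mul hq
  have hu : u ≠ 0 := right_ne_zero_of_mul hq
  rw [natDegree_mul hp hu] at hd
  have : IsUnit u := isUnit_iff_degree_eq_zero.2 (by rw [degree_eq_natDegree hu]; simp; omega)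
  exact (this.mul_right_dvd).2 dvd_rfl

end

/-! ### Linear factors of the cubic in τ -/

section
open Polynomial

/-- The cubic `c₄ Y³ + c₃ Y² + c₂ Y + c₁` in `ℝ[X][Y]`. -/
noncomputable def cubicPoly (c₁ c₂ c₃ c₄ : ℝ[X]) : ℝ[X][X] :=
  Cubic.toPoly ⟨c₄, c₃, c₂, c₁⟩

theorem evalEval_cubicPoly (c₁ c₂ c₃ c₄ : ℝ[X]) (s τ : ℝ) :
    evalEval s τ (cubicPoly c₁ c₂ c₃ c₄) =
      eval s c₄ * τ ^ 3 + eval s c₃ * τ ^ 2 + eval s c₂ * τ + eval s c₁ := by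
  simp [cubicPoly, Cubic.toPoly, evalEval]

theorem coeff_zero_cubicPoly (c₁ c₂ c₃ c₄ : ℝ[X]) : (cubicPoly c₁ c₂ c₃ c₄).coeff 0 = c₁ := by
  simp [cubicPoly]

/-- The equation says that τ = -b/a is a root of the cubic. If deg a ≤ deg b + 1, the term c₄b³
would have strictly larger degree than all the others. -/
theorem natDegree_add_two_le_of_root {a b c₁ c₂ c₃ c₄ : ℝ[X]} (hb : b ≠ 0)
    (hc₁ : c₁.natDegree ≤ 2) (hc₂ : c₂.natDegree ≤ 4) (hc₃ : c₃.natDegree ≤ 6)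
    (hc₄ : c₄.natDegree = 8)
    (h : c₄ * b ^ 3 = c₃ * (a * b ^ 2) - c₂ * (a ^ 2 * b) + c₁ * a ^ 3) :
    b.natDegree + 2 ≤ a.natDegree := by
  have hc : c₄ ≠ 0 := by rintro rfl; simp at hc₄
  have e0 : (c₄ * b ^ 3).natDegree = 8 + 3 * b.natDegree := by
    rw [natDegree_mul hc (pow_ne_zero _ hb), natDegree_pow, hc₄]
  have e1 : (c₃ * (a * b ^ 2)).natDegree ≤ 6 + (a.natDegree + 2 * b.natDegree) := by
    refine natDegree_mul_le.trans (add_le_add hc₃ (natDegree_mul_le.trans ?_))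
    rw [natDegree_pow]
  have e2 : (c₂ * (a ^ 2 * b)).natDegree ≤ 4 + (2 * a.natDegree + b.natDegree) := by
    refine natDegree_mul_le.trans (add_le_add hc₂ (natDegree_mul_le.trans ?_))
    rw [natDegree_pow]
  have e3 : (c₁ * a ^ 3).natDegree ≤ 2 + 3 * a.natDegree := by
    refine natDegree_mul_le.trans (add_le_add hc₁ ?_)
    rw [natDegree_pow]
  have e4 := natDegree_add_le (c₃ * (a * b ^ 2) - c₂ * (a ^ 2 * b)) (c₁ * a ^ 3)
  have e5 := natDegree_sub_le (c₃ * (a * b ^ 2)) (c₂ * (a ^ 2 * b))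
  rw [← h, e0] at e4
  omega

section
variable {c₁ c₂ c₃ c₄ : ℝ[X]} {g : ℝ[X][X]}

theorem dvd_of_infinite_zeros (h0 : c₁ ≠ 0)
    (hzero : ∀ s τ, τ ≠ 0 → evalEval s τ (cubicPoly c₁ c₂ c₃ c₄) = 0 → evalEval s τ g = 0)
    {p : ℝ[X][X]} (hp : Irreducible p) (hd : p.natDegree ≠ 0) (hpG : p ∣ cubicPoly c₁ c₂ c₃ c₄)
    (hinf : {s : ℝ | ∃ τ, evalEval s τ p = 0}.Infinite) : p ∣ g := by
  apply dvd_of_infinite_common_zeros hp hd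
  -- Nothing is known about g at τ = 0, but a zero of p there forces c₁(s) = 0, which excludes only
  -- finitely many s.
  refine (hinf.sdiff (finite_setOfPred_isRoot h0)).mono ?_
  rintro s ⟨⟨τ, hτ⟩, hs⟩
  have hG : evalEval s τ (cubicPoly c₁ c₂ c₃ c₄) = 0 := by
    obtain ⟨q, hq⟩ := hpG
    rw [hq, evalEval_mul, hτ, zero_mul]
  refine ⟨τ, hτ, hzero s τ ?_ hG⟩
  rintro rfl
  exact hs (by simpa [evalEval_cubicPoly] using hG)

/-- The leading coefficient a divides c₄, so it has no real zero. Hence its degree is even and -b/a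
is a real root over every s, which makes the factor divide g. -/
theorem linear_factor (h1 : c₁.natDegree = 2) (h2 : c₂.natDegree ≤ 4) (h3 : c₃.natDegree ≤ 6)
    (h4 : c₄.natDegree = 8) (h4' : ∀ s, eval s c₄ ≠ 0)
    (hG : (cubicPoly c₁ c₂ c₃ c₄).IsPrimitive)
    (hzero : ∀ s τ, τ ≠ 0 → evalEval s τ (cubicPoly c₁ c₂ c₃ c₄) = 0 → evalEval s τ g = 0)
    {p : ℝ[X][X]} (hd : p.natDegree = 1) (hpG : p ∣ cubicPoly c₁ c₂ c₃ c₄) :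
    p ∣ g ∧ p.coeff 0 ∣ g.coeff 0 ∧ (p.coeff 0).natDegree + 2 ≤ (p.coeff 1).natDegree ∧
      Even (p.coeff 1).natDegree ∧ p.coeff 0 ≠ 0 ∧ p.coeff 1 ≠ 0 := by
  have h0 : c₁ ≠ 0 := by rintro rfl; simp at h1
  set a := p.coeff 1 with ha
  set b := p.coeff 0 with hb
  have hp : p = C a * X + C b := eq_X_add_C_of_natDegree_le_one hd.le
  have hprim := isPrimitive_of_dvd hG hpG
  have hirr : Irreducible p := by
    apply irreducible_of_degree_eq_one_of_isRelPrime_coeff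
    · rw [degree_eq_natDegree (by rintro rfl; simp at hd), hd]; rfl
    · intro d hdb hda
      apply hprim d
      rw [hp]
      exact dvd_add (Dvd.dvd.mul_right (C.map_dvd hda) _) (C.map_dvd hdb)
  obtain ⟨q, hq⟩ := hpG
  have ha4 : a ∣ c₄ := by
    have : q.natDegree = 2 := by
      have hc4 : c₄ ≠ 0 := by rintro rfl; simp at h4
      have := Cubic.natDegree_of_a_ne_zero' (b := c₃) (c := c₂) (d := c₁) hc4
      change (cubicPoly c₁ c₂ c₃ c₄).natDegree = 3 at this
      rw [hq, natDegree_mul hirr.ne_zero, hd] at this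
      · omega
      · rintro rfl; simp at this
    have h := congrArg (coeff · 3) hq
    simp only [cubicPoly, Cubic.coeff_eq_a] at h
    rw [show 3 = 1 + 2 by rfl, coeff_mul_add_eq_of_natDegree_le hd.le this.le] at h
    exact ⟨_, h⟩
  have ha' : ∀ s, eval s a ≠ 0 := fun s hs => h4' s (by
    obtain ⟨u, hu⟩ := ha4
    rw [hu, eval_mul, hs, zero_mul])
  have ha0 : a ≠ 0 := by intro h; simpa [h] using ha' 0
  have hb1 : b ∣ c₁ := by
    have h := congrArg (coeff · 0) hq
    simp only [coeff_zero_cubicPoly, mul_coeff_zero] at h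
    exact ⟨_, h⟩
  have hb0 : b ≠ 0 := ne_zero_of_dvd_ne_zero h0 hb1
  have hpg : p ∣ g := by
    refine dvd_of_infinite_zeros h0 hzero hirr (by omega) ⟨q, hq⟩ ?_
    convert Set.infinite_univ (α := ℝ)
    ext s
    simp only [Set.mem_ofPred_eq, Set.mem_univ, iff_true]
    refine ⟨-eval s b / eval s a, ?_⟩
    rw [hp]
    have := ha' s
    simp only [evalEval, eval_add, eval_mul, eval_C, eval_X]
    field_simp
    ring
  refine ⟨hpg, ?_, ?_, ?_, hb0, ha0⟩
  · obtain ⟨u, hu⟩ := hpg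
    exact ⟨u.coeff 0, by rw [hu, mul_coeff_zero]⟩
  · refine natDegree_add_two_le_of_root hb0 h1.le h2 h3 h4 ?_
    apply Polynomial.funext
    intro s
    have h := congrArg (evalEval s (-eval s b / eval s a)) hq
    have hz : evalEval s (-eval s b / eval s a) p = 0 := by
      rw [hp]
      have := ha' s
      simp only [evalEval, eval_add, eval_mul, eval_C, eval_X]
      field_simp
      ring
    rw [evalEval_mul, hz, zero_mul, evalEval_cubicPoly] at h
    have := ha' s
    field_simp at h
    simp only [eval_add, eval_sub, eval_mul, eval_pow]
    linear_combination -h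
  · by_contra hodd
    obtain ⟨s, hs⟩ := exists_eval_eq_zero_of_odd_natDegree (Nat.not_even_iff_odd.1 hodd)
    exact ha' s hs

end

end

/-! ### Divisibility by the lowest coefficient of the cubic -/

section
open Polynomial

theorem natDegree_ne_zero_of_isPrimitive {R : Type*} [CommRing R] {p : R[X]} (hp : p.IsPrimitive)
    (hu : ¬ IsUnit p) : p.natDegree ≠ 0 := by
  intro h
  rw [eq_C_of_natDegree_eq_zero h] at hu hp
  exact hu (isUnit_C.2 (hp _ dvd_rfl))

/-- A positive discriminant at one s persists on an open set, which is infinite, and gives real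
roots there. -/
theorem discrim_nonpos_of_finite {a b c : ℝ[X]} (ha : ∀ s, eval s a ≠ 0)
    (hfin : {s : ℝ | ∃ τ, eval s a * τ ^ 2 + eval s b * τ + eval s c = 0}.Finite) (s : ℝ) :
    eval s b ^ 2 ≤ 4 * eval s a * eval s c := by
  by_contra! hs
  have hopen : IsOpen {s : ℝ | 4 * eval s a * eval s c < eval s b ^ 2} := by
    apply isOpen_lt
    · exact (continuous_const.mul a.continuous).mul c.continuous
    · exact b.continuous.pow 2
  refine infinite_of_mem_nhds s (hopen.mem_nhds hs) (hfin.subset ?_)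
  intro t ht
  have hd : 0 ≤ discrim (eval t a) (eval t b) (eval t c) := by
    have : 4 * eval t a * eval t c < eval t b ^ 2 := ht
    rw [discrim]; linarith
  obtain ⟨τ, hτ⟩ := exists_quadratic_eq_zero (ha t)
    ⟨√(discrim (eval t a) (eval t b) (eval t c)), (Real.mul_self_sqrt hd).symm⟩
  exact ⟨τ, by rw [sq]; exact hτ⟩

section
variable {c₁ c₂ c₃ c₄ : ℝ[X]} {g : ℝ[X][X]}

/-- Only one configuration resists the degree count: b constant and a, c' of degree 2, with a
quadratic factor having real zeros over finitely many s. The hypothesis `hexc` rules it out,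
normalized so that the linear factor is aτ - 1; geometry enters only there. -/
theorem coeff_zero_dvd_of_factor (h1 : c₁.natDegree = 2) (h2 : c₂.natDegree ≤ 4)
    (h3 : c₃.natDegree ≤ 6) (h4 : c₄.natDegree = 8) (h4' : ∀ s, eval s c₄ ≠ 0)
    (hG : (cubicPoly c₁ c₂ c₃ c₄).IsPrimitive)
    (hzero : ∀ s τ, τ ≠ 0 → evalEval s τ (cubicPoly c₁ c₂ c₃ c₄) = 0 → evalEval s τ g = 0)
    (hexc : ∀ a a' b' : ℝ[X], a.natDegree = 2 → c₄ = a * a' → c₃ = a * b' - a' →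
      c₂ = -(a * c₁) - b' → ¬ ∀ s, eval s b' ^ 2 + 4 * eval s a' * eval s c₁ ≤ 0)
    {p h : ℝ[X][X]} (hph : cubicPoly c₁ c₂ c₃ c₄ = p * h) (hp : p.natDegree = 1)
    (hh : h.natDegree = 2) : c₁ ∣ g.coeff 0 := by
  have h0 : c₁ ≠ 0 := by rintro rfl; simp at h1
  have hlin := fun {q : ℝ[X][X]} (hq : q.natDegree = 1) (hqG : q ∣ cubicPoly c₁ c₂ c₃ c₄) =>
    linear_factor h1 h2 h3 h4 h4' hG hzero hq hqG
  have hdeg : ∀ {b : ℝ[X]}, b ∣ c₁ → b ∣ g.coeff 0 → b.natDegree = 2 → c₁ ∣ g.coeff 0 :=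
    fun hb hbg hd => (dvd_of_dvd_of_natDegree_eq hb h0 (hd.trans h1.symm)).trans hbg
  obtain ⟨hpg, hbg, hab, hae, hb0, ha0⟩ := hlin hp ⟨h, hph⟩
  have hpe := eq_X_add_C_of_natDegree_le_one hp.le
  have hhe := eq_quadratic_of_degree_le_two (p := h) (natDegree_le_iff_degree_le.1 hh.le)
  set a := p.coeff 1
  set b := p.coeff 0
  set a' := h.coeff 2
  set b' := h.coeff 1
  set c' := h.coeff 0
  have hcub : (⟨c₄, c₃, c₂, c₁⟩ : Cubic ℝ[X]) =
      ⟨a * a', a * b' + b * a', a * c' + b * b', b * c'⟩ := by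
    refine (Cubic.toPoly_injective _ _).1 ?_
    change cubicPoly c₁ c₂ c₃ c₄ = _
    rw [hph, hpe, hhe]
    simp only [Cubic.toPoly, C_add, C_mul]
    ring
  obtain ⟨e4, e3, e2, e1⟩ := Cubic.mk.inj hcub
  have ha' : ∀ s, eval s a' ≠ 0 := fun s hs => h4' s (by rw [e4, eval_mul, hs, mul_zero])
  have ha'0 : a' ≠ 0 := by intro h; simpa [h] using ha' 0
  have hc'0 : c' ≠ 0 := by rintro h; rw [e1, h, mul_zero] at h0; exact h0 rfl
  have d4 : a.natDegree + a'.natDegree = 8 := by rw [← natDegree_mul ha0 ha'0, ← e4, h4]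
  have d1 : b.natDegree + c'.natDegree = 2 := by rw [← natDegree_mul hb0 hc'0, ← e1, h1]
  have hhprim : h.IsPrimitive := isPrimitive_of_dvd hG ⟨p, by rw [hph, mul_comm]⟩
  by_cases hinf : {s : ℝ | ∃ τ, evalEval s τ h = 0}.Infinite
  · by_cases hirr : Irreducible h
    · have hhg : h ∣ g := dvd_of_infinite_zeros h0 hzero hirr (by omega)
        ⟨p, by rw [hph, mul_comm]⟩ hinf
      obtain ⟨q, rfl⟩ := hpg
      rcases hirr.prime.dvd_or_dvd hhg with hd | ⟨u, rfl⟩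
      · have := natDegree_le_of_dvd hd (by rintro rfl; simp at hp)
        omega
      · refine ⟨u.coeff 0, ?_⟩
        rw [mul_coeff_zero, mul_coeff_zero, e1, mul_assoc]
    · have hnu : ¬ IsUnit h := fun hu => by
        have := natDegree_eq_zero_of_isUnit hu
        omega
      obtain ⟨x, y, hx, hy, hxy⟩ : ∃ x y, ¬ IsUnit x ∧ ¬ IsUnit y ∧ h = x * y := by
        simpa [irreducible_iff, hnu, not_or, and_comm, and_assoc, and_left_comm] using hirr
      have hxd := natDegree_ne_zero_of_isPrimitive (isPrimitive_of_dvd hhprim ⟨y, hxy⟩) hx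
      have hyd := natDegree_ne_zero_of_isPrimitive
        (isPrimitive_of_dvd hhprim ⟨x, by rw [hxy, mul_comm]⟩) hy
      have hx0 : x ≠ 0 := by rintro rfl; simp at hxd
      have hy0 : y ≠ 0 := by rintro rfl; simp at hyd
      have hsum : x.natDegree + y.natDegree = 2 := by rw [← natDegree_mul hx0 hy0, ← hxy, hh]
      have hx1 : x.natDegree = 1 := by omega
      have hy1 : y.natDegree = 1 := by omega
      obtain ⟨-, hxg, hxab, hxe, hxb0, hxa0⟩ := hlin hx1 ⟨p * y, by rw [hph, hxy]; ring⟩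
      obtain ⟨-, hyg, hyab, hye, hyb0, hya0⟩ := hlin hy1 ⟨p * x, by rw [hph, hxy]; ring⟩
      have ec : c' = x.coeff 0 * y.coeff 0 := by rw [← mul_coeff_zero, ← hxy]
      have ea : a' = x.coeff 1 * y.coeff 1 := by
        rw [← coeff_mul_add_eq_of_natDegree_le hx1.le hy1.le, ← hxy]
      rw [ec, natDegree_mul hxb0 hyb0] at d1
      rw [ea, natDegree_mul hxa0 hya0] at d4
      obtain ⟨k, hk⟩ := hae
      obtain ⟨l, hl⟩ := hxe
      obtain ⟨m, hm⟩ := hye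
      -- The constant terms have total degree 2 and the leading coefficients total degree 8 = 2 +
      -- 3·2, so each gap is exactly 2. Leading degrees are even, hence so are the constant ones,
      -- and one of these is 2.
      have : b.natDegree = 2 ∨ (x.coeff 0).natDegree = 2 ∨ (y.coeff 0).natDegree = 2 := by omega
      rcases this with hb | hb | hb
      · exact hdeg ⟨_, e1⟩ hbg hb
      · exact hdeg ⟨b * y.coeff 0, by rw [e1, ec]; ring⟩ hxg hb
      · exact hdeg ⟨b * x.coeff 0, by rw [e1, ec]; ring⟩ hyg hb
  · rw [Set.not_infinite] at hinf
    have hdisc := discrim_nonpos_of_finite (b := b') (c := c') ha' (by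
      convert hinf using 5 with s τ
      rw [hhe]
      simp [evalEval])
    have hdd : 2 * b'.natDegree ≤ a'.natDegree + c'.natDegree := by
      rw [← natDegree_mul ha'0 hc'0, ← natDegree_C_mul (a := (4 : ℝ)) (p := a' * c') (by norm_num)]
      exact two_mul_natDegree_le_of_sq_le fun s => by simpa [mul_assoc] using hdisc s
    rcases Nat.eq_zero_or_pos c'.natDegree with hc | hc
    · exact hdeg ⟨_, e1⟩ hbg (by omega)
    exfalso
    -- If ac' had degree above 4 ≥ deg c₂, then bb' would have to reach that degree, against the
    -- bound on deg b'.
    have hda : a.natDegree + c'.natDegree ≤ 4 := by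
      by_contra! hlt
      have hac : (a * c').natDegree = a.natDegree + c'.natDegree := natDegree_mul ha0 hc'0
      have hbb : (b * b').natDegree ≤ b.natDegree + b'.natDegree := natDegree_mul_le
      have : (a * c').natDegree ≤ max c₂.natDegree (b * b').natDegree := by
        rw [show a * c' = c₂ - b * b' by rw [e2]; ring]
        exact natDegree_sub_le _ _
      omega
    obtain ⟨k, hk⟩ := hae
    -- From deg a ≥ deg b + 2 = 4 - deg c' the sum deg a + deg c' is exactly 4; deg a is even and 0
    -- < deg c' ≤ 2.
    have hc2 : c'.natDegree = 2 := by omega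
    have hbd : b.natDegree = 0 := by omega
    obtain ⟨β, hβ⟩ := natDegree_eq_zero.1 hbd
    have hβ0 : β ≠ 0 := by rintro rfl; exact hb0 (by rw [← hβ, C_0])
    have hCβ : (C β : ℝ[X]) * C β⁻¹ = 1 := by rw [← C_mul, mul_inv_cancel₀ hβ0, C_1]
    rw [← hβ] at e1 e2 e3
    -- Dividing the linear factor by -β and multiplying the quadratic one by -β makes their constant
    -- terms -1 and -c₁.
    refine hexc (-(C β⁻¹ * a)) (-(C β * a')) (-(C β * b')) ?_ ?_ ?_ ?_ ?_
    · rw [natDegree_neg, natDegree_C_mul (inv_ne_zero hβ0)]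
      omega
    · rw [e4]; linear_combination -(a * a') * hCβ
    · rw [e3]; linear_combination -(a * b') * hCβ
    · rw [e2, e1]; linear_combination -(a * c') * hCβ
    · intro s
      rw [e1]
      simp only [eval_neg, eval_mul, eval_C]
      nlinarith [hdisc s, mul_nonneg (sq_nonneg β) (sub_nonneg.2 (hdisc s))]

theorem coeff_zero_dvd (h1 : c₁.natDegree = 2) (h2 : c₂.natDegree ≤ 4)
    (h3 : c₃.natDegree ≤ 6) (h4 : c₄.natDegree = 8) (h4' : ∀ s, eval s c₄ ≠ 0)
    (hG : (cubicPoly c₁ c₂ c₃ c₄).IsPrimitive)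
    (hzero : ∀ s τ, τ ≠ 0 → evalEval s τ (cubicPoly c₁ c₂ c₃ c₄) = 0 → evalEval s τ g = 0)
    (hexc : ∀ a a' b' : ℝ[X], a.natDegree = 2 → c₄ = a * a' → c₃ = a * b' - a' →
      c₂ = -(a * c₁) - b' → ¬ ∀ s, eval s b' ^ 2 + 4 * eval s a' * eval s c₁ ≤ 0) :
    c₁ ∣ g.coeff 0 := by
  have h0 : c₁ ≠ 0 := by rintro rfl; simp at h1
  have hd3 : (cubicPoly c₁ c₂ c₃ c₄).natDegree = 3 :=
    Cubic.natDegree_of_a_ne_zero' (by rintro rfl; simp at h4)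
  by_cases hirr : Irreducible (cubicPoly c₁ c₂ c₃ c₄)
  · obtain ⟨u, hu⟩ : cubicPoly c₁ c₂ c₃ c₄ ∣ g := by
      refine dvd_of_infinite_zeros h0 hzero hirr (by omega) dvd_rfl ?_
      convert Set.infinite_univ (α := ℝ)
      ext s
      simp only [Set.mem_ofPred_eq, Set.mem_univ, iff_true]
      have hodd : Odd (Cubic.toPoly ⟨eval s c₄, eval s c₃, eval s c₂, eval s c₁⟩).natDegree := by
        rw [Cubic.natDegree_of_a_ne_zero' (h4' s)]
        decide
      obtain ⟨τ, hτ⟩ := exists_eval_eq_zero_of_odd_natDegree hodd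
      exact ⟨τ, by rw [evalEval_cubicPoly]; simpa [Cubic.toPoly] using hτ⟩
    exact ⟨u.coeff 0, by rw [hu, mul_coeff_zero, coeff_zero_cubicPoly]⟩
  · have hnu : ¬ IsUnit (cubicPoly c₁ c₂ c₃ c₄) := fun hu => by
      have := natDegree_eq_zero_of_isUnit hu
      omega
    obtain ⟨x, y, hx, hy, hxy⟩ : ∃ x y, ¬ IsUnit x ∧ ¬ IsUnit y ∧
        cubicPoly c₁ c₂ c₃ c₄ = x * y := by
      simpa [irreducible_iff, hnu, not_or, and_comm, and_assoc, and_left_comm] using hirr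
    have hxd := natDegree_ne_zero_of_isPrimitive (isPrimitive_of_dvd hG ⟨y, hxy⟩) hx
    have hyd := natDegree_ne_zero_of_isPrimitive
      (isPrimitive_of_dvd hG ⟨x, by rw [hxy, mul_comm]⟩) hy
    have hx0 : x ≠ 0 := by rintro rfl; simp at hxd
    have hy0 : y ≠ 0 := by rintro rfl; simp at hyd
    have hsum : x.natDegree + y.natDegree = 3 := by rw [← natDegree_mul hx0 hy0, ← hxy, hd3]
    rcases (by omega : x.natDegree = 1 ∨ y.natDegree = 1) with hd | hd
    · exact coeff_zero_dvd_of_factor h1 h2 h3 h4 h4' hG hzero hexc hxy hd (by omega)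
    · exact coeff_zero_dvd_of_factor h1 h2 h3 h4 h4' hG hzero hexc (hxy.trans (mul_comm _ _)) hd
        (by omega)

end

end

/-! ### Complex binary quadratic forms of definite modulus -/

/-- `f` is a binary quadratic form with real coefficients. -/
def IsBinaryQuadratic (f : ℝ → ℝ → ℝ) : Prop :=
  ∃ c₀ c₁ c₂ : ℝ, ∀ s t, f s t = c₀ * t ^ 2 + c₁ * (s * t) + c₂ * s ^ 2

namespace IsBinaryQuadratic

theorem add {f g : ℝ → ℝ → ℝ} (hf : IsBinaryQuadratic f) (hg : IsBinaryQuadratic g) :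
    IsBinaryQuadratic fun s t => f s t + g s t := by
  obtain ⟨a, b, c, hf⟩ := hf
  obtain ⟨a', b', c', hg⟩ := hg
  exact ⟨a + a', b + b', c + c', fun s t => by simp only [hf, hg]; ring⟩

theorem const_mul {f : ℝ → ℝ → ℝ} (k : ℝ) (hf : IsBinaryQuadratic f) :
    IsBinaryQuadratic fun s t => k * f s t := by
  obtain ⟨a, b, c, hf⟩ := hf
  exact ⟨k * a, k * b, k * c, fun s t => by simp only [hf]; ring⟩

theorem comp_linear {f : ℝ → ℝ → ℝ} (hf : IsBinaryQuadratic f) (k l m n : ℝ) :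
    IsBinaryQuadratic fun s t => f (k * s + l * t) (m * s + n * t) := by
  obtain ⟨a, b, c, hf⟩ := hf
  exact ⟨a * n ^ 2 + b * (l * n) + c * l ^ 2,
    a * (2 * m * n) + b * (k * n + l * m) + c * (2 * k * l),
    a * m ^ 2 + b * (k * m) + c * k ^ 2, fun s t => by simp only [hf]; ring⟩

/-- A definite binary quadratic form is, up to a factor, a sum of two squares. -/
theorem exists_pos_mul_of_ne_zero {q : ℝ → ℝ → ℝ} (hq : IsBinaryQuadratic q)
    (hne : ∀ s t, (s, t) ≠ 0 → q s t ≠ 0) :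
    ∃ k l δ : ℝ, k ≠ 0 ∧ δ ≠ 0 ∧ ∀ s t, k * q s t = (k * s + l * t) ^ 2 + (δ * t) ^ 2 := by
  obtain ⟨q₀, q₁, q₂, hq⟩ := hq
  have h2 : q₂ ≠ 0 := by simpa [hq] using hne 1 0 (by simp)
  have hd : 0 < 4 * q₀ * q₂ - q₁ ^ 2 := by
    by_contra! hle
    have hd : 0 ≤ discrim q₂ q₁ q₀ := by rw [discrim]; linarith
    obtain ⟨τ, hτ⟩ := exists_quadratic_eq_zero h2
      ⟨√(discrim q₂ q₁ q₀), (Real.mul_self_sqrt hd).symm⟩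
    exact hne τ 1 (by simp) (by rw [hq]; linarith)
  refine ⟨q₂, q₁ / 2, √(4 * q₀ * q₂ - q₁ ^ 2) / 2, h2, by positivity, fun s t => ?_⟩
  rw [hq, mul_pow, div_pow, Real.sq_sqrt hd.le]
  ring

/-- Write x + iy = K₀t² + K₁st + K₂s². Comparing coefficients gives |K₀| = |K₂| = |c| and K₁
orthogonal to both. If K₁ = 0, then K₀ = K₂. Otherwise K₂ = -K₀ and the form is K₀(t + iεs)² with ε
= ±1, so complex square roots give surjectivity. -/
theorem const_or_surjective_of_sum_sq {x y : ℝ → ℝ → ℝ} (hx : IsBinaryQuadratic x)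
    (hy : IsBinaryQuadratic y) {c : ℝ} (hc : c ≠ 0)
    (h : ∀ s t, x s t ^ 2 + y s t ^ 2 = (c * (s ^ 2 + t ^ 2)) ^ 2) :
    (∃ α β, ∀ s t, x s t = α * (s ^ 2 + t ^ 2) ∧ y s t = β * (s ^ 2 + t ^ 2)) ∨
      ∀ ξ η, ∃ s t, x s t = ξ ∧ y s t = η := by
  obtain ⟨x₀, x₁, x₂, hx⟩ := hx
  obtain ⟨y₀, y₁, y₂, hy⟩ := hy
  simp only [hx, hy] at h ⊢
  have e2 : x₂ ^ 2 + y₂ ^ 2 = c ^ 2 := by linarith [h 1 0]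
  have e0 : x₀ ^ 2 + y₀ ^ 2 = c ^ 2 := by linarith [h 0 1]
  have o0 : x₀ * x₁ + y₀ * y₁ = 0 := by linarith [h 1 1, h 1 (-1), h 1 2, h 1 (-2)]
  have o2 : x₂ * x₁ + y₂ * y₁ = 0 := by linarith [h 1 1, h 1 (-1), h 1 2, h 1 (-2)]
  have e1 : (x₀ + x₂) ^ 2 + x₁ ^ 2 + (y₀ + y₂) ^ 2 + y₁ ^ 2 = 4 * c ^ 2 := by
    linarith [h 1 1, h 1 (-1)]
  by_cases hK : x₁ ^ 2 + y₁ ^ 2 = 0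
  · left
    have hx1 : x₁ = 0 := by nlinarith [sq_nonneg x₁, sq_nonneg y₁]
    have hy1 : y₁ = 0 := by nlinarith [sq_nonneg x₁, sq_nonneg y₁]
    have hs : (x₀ - x₂) ^ 2 + (y₀ - y₂) ^ 2 = 0 := by rw [hx1, hy1] at e1; linarith
    have hx02 : x₀ - x₂ = 0 := by nlinarith [sq_nonneg (x₀ - x₂), sq_nonneg (y₀ - y₂)]
    have hy02 : y₀ - y₂ = 0 := by nlinarith [sq_nonneg (x₀ - x₂), sq_nonneg (y₀ - y₂)]
    refine ⟨x₀, y₀, fun s t => ⟨?_, ?_⟩⟩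
    · rw [hx1]; linear_combination -s ^ 2 * hx02
    · rw [hy1]; linear_combination -s ^ 2 * hy02
  · right
    have hcross : x₀ * y₂ - y₀ * x₂ = 0 := by
      have e1 : (x₀ * y₂ - y₀ * x₂) * x₁ = 0 := by linear_combination y₂ * o0 - y₀ * o2
      have e2 : (x₀ * y₂ - y₀ * x₂) * y₁ = 0 := by linear_combination -x₂ * o0 + x₀ * o2
      by_contra hne
      have h1 := (mul_eq_zero.1 e1).resolve_left hne
      have h2 := (mul_eq_zero.1 e2).resolve_left hne
      exact hK (by rw [h1, h2]; ring)
    have hsq : (x₀ * x₂ + y₀ * y₂) ^ 2 = (c ^ 2) ^ 2 := by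
      linear_combination -(x₀ * y₂ - y₀ * x₂) * hcross + (x₂ ^ 2 + y₂ ^ 2) * e0 + c ^ 2 * e2
    have hinner : x₀ * x₂ + y₀ * y₂ = -c ^ 2 := by
      rcases sq_eq_sq_iff_eq_or_eq_neg.1 hsq with h | h
      · exact absurd (by linarith) hK
      · exact h
    have hs : (x₀ + x₂) ^ 2 + (y₀ + y₂) ^ 2 = 0 := by linarith
    have hx02 : x₂ = -x₀ := by nlinarith [sq_nonneg (x₀ + x₂), sq_nonneg (y₀ + y₂)]
    have hy02 : y₂ = -y₀ := by nlinarith [sq_nonneg (x₀ + x₂), sq_nonneg (y₀ + y₂)]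
    have hc2 : c ^ 2 ≠ 0 := pow_ne_zero _ hc
    have hK4 : x₁ ^ 2 + y₁ ^ 2 = 4 * c ^ 2 := by linarith
    obtain ⟨ε, hε⟩ : ∃ ε, x₀ * y₁ - y₀ * x₁ = 2 * c ^ 2 * ε :=
      ⟨(x₀ * y₁ - y₀ * x₁) / (2 * c ^ 2), by field_simp⟩
    have hε2 : ε ^ 2 = 1 := by
      have : (2 * c ^ 2 * ε) ^ 2 = 4 * (c ^ 2) ^ 2 := by
        rw [← hε]
        linear_combination (x₁ ^ 2 + y₁ ^ 2) * e0 + c ^ 2 * hK4 - (x₀ * x₁ + y₀ * y₁) * o0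
      apply mul_left_cancel₀ (pow_ne_zero 2 hc2)
      linarith
    have hx1 : x₁ = -2 * ε * y₀ := by
      apply mul_left_cancel₀ hc2
      linear_combination x₀ * o0 - y₀ * hε - x₁ * e0
    have hy1 : y₁ = 2 * ε * x₀ := by
      apply mul_left_cancel₀ hc2
      linear_combination y₀ * o0 + x₀ * hε - y₁ * e0
    intro ξ η
    have hK0 : (⟨x₀, y₀⟩ : ℂ) ≠ 0 := by
      intro h0
      have h1 : x₀ = 0 := congrArg Complex.re h0
      have h2 : y₀ = 0 := congrArg Complex.im h0
      rw [h1, h2] at e0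
      exact hc2 (by linarith)
    obtain ⟨w, hw⟩ := IsAlgClosed.exists_pow_nat_eq ((⟨ξ, η⟩ : ℂ) / ⟨x₀, y₀⟩) (n := 2) (by simp)
    have hw' : (⟨x₀, y₀⟩ : ℂ) * w ^ 2 = ⟨ξ, η⟩ := by rw [hw]; field_simp
    have hre := congrArg Complex.re hw'
    have him := congrArg Complex.im hw'
    simp only [sq, Complex.mul_re, Complex.mul_im] at hre him
    refine ⟨ε * w.im, w.re, ?_, ?_⟩
    · rw [hx1, hx02, ← hre]
      linear_combination (-2 * y₀ * w.im * w.re - x₀ * w.im ^ 2) * hε2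
    · rw [hy1, hy02, ← him]
      linear_combination (2 * x₀ * w.im * w.re - y₀ * w.im ^ 2) * hε2

/-- A complex binary quadratic form `x + i y` whose modulus is that of a definite real binary
quadratic form `q` is either a constant multiple of `q` or surjective onto `ℂ`. -/
theorem const_or_surjective {x y q : ℝ → ℝ → ℝ} (hx : IsBinaryQuadratic x)
    (hy : IsBinaryQuadratic y) (hq : IsBinaryQuadratic q)
    (hne : ∀ s t, (s, t) ≠ 0 → q s t ≠ 0) (h : ∀ s t, x s t ^ 2 + y s t ^ 2 = q s t ^ 2) :
    (∃ α β, ∀ s t, x s t = α * q s t ∧ y s t = β * q s t) ∨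
      ∀ ξ η, ∃ s t, x s t = ξ ∧ y s t = η := by
  obtain ⟨k, l, δ, hk, hδ, hkq⟩ := hq.exists_pos_mul_of_ne_zero hne
  -- The substitution inverts (s, t) ↦ (ks + lt, δt), which turns kq into a sum of two squares.
  have hsub : ∀ s t, q (k⁻¹ * s + -(l * k⁻¹ * δ⁻¹) * t) (0 * s + δ⁻¹ * t) =
      k⁻¹ * (s ^ 2 + t ^ 2) := by
    intro s t
    apply mul_left_cancel₀ hk
    rw [hkq]
    field_simp
    ring
  rcases const_or_surjective_of_sum_sq (hx.comp_linear k⁻¹ (-(l * k⁻¹ * δ⁻¹)) 0 δ⁻¹)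
    (hy.comp_linear k⁻¹ (-(l * k⁻¹ * δ⁻¹)) 0 δ⁻¹) (inv_ne_zero hk)
    (fun s t => by rw [h, hsub]) with ⟨α, β, hαβ⟩ | hs
  · left
    refine ⟨α * k, β * k, fun s t => ?_⟩
    have := hαβ (k * s + l * t) (δ * t)
    rw [← hkq] at this
    have e1 : k⁻¹ * (k * s + l * t) + -(l * k⁻¹ * δ⁻¹) * (δ * t) = s := by field_simp; ring
    have e2 : 0 * (k * s + l * t) + δ⁻¹ * (δ * t) = t := by field_simp; ring
    rw [e1, e2] at this
    exact ⟨by rw [this.1]; ring, by rw [this.2]; ring⟩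
  · right
    intro ξ η
    obtain ⟨s, t, hst⟩ := hs ξ η
    exact ⟨_, _, hst⟩

end IsBinaryQuadratic

/-! ### Excluding the exceptional curve on the torus -/

/-- No circle on the ring torus can be seen from a point `P` of the torus in such a way that every
line joining `P` to the circle meets the torus in at most two further coinciding real points:
here `V s t` is the direction of the line, `P + V / a` runs through the circle, and `hdisc` says
that the quadratic for the two remaining points has nonpositive discriminant. -/
theorem torus_circle_discrim_pos {R r x₀ y₀ z₀ u₀ : ℝ} (hr : 0 < r) (hrR : r < R)
    (hu : u₀ = x₀ ^ 2 + y₀ ^ 2 + z₀ ^ 2 + (R ^ 2 - r ^ 2))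
    (hT : u₀ ^ 2 = 4 * R ^ 2 * (x₀ ^ 2 + y₀ ^ 2))
    {V₁ V₂ V₃ a N p e c₁ c₂ : ℝ → ℝ → ℝ}
    (hV₁ : IsBinaryQuadratic V₁) (hV₂ : IsBinaryQuadratic V₂) (hV₃ : IsBinaryQuadratic V₃)
    (ha : IsBinaryQuadratic a) (hN : IsBinaryQuadratic N)
    (hane : ∀ s t, (s, t) ≠ 0 → a s t ≠ 0) (hNne : ∀ s t, (s, t) ≠ 0 → N s t ≠ 0)
    (haN : ∀ s t, V₁ s t ^ 2 + V₂ s t ^ 2 + V₃ s t ^ 2 = a s t * N s t)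
    (hp : ∀ s t, p s t = x₀ * V₁ s t + y₀ * V₂ s t + z₀ * V₃ s t)
    (he : ∀ s t, e s t = x₀ * V₁ s t + y₀ * V₂ s t)
    (hc₁ : ∀ s t, c₁ s t = 4 * u₀ * p s t - 8 * R ^ 2 * e s t)
    (hc₂ : ∀ s t, c₂ s t = 4 * p s t ^ 2 + 2 * u₀ * (a s t * N s t) -
      4 * R ^ 2 * (V₁ s t ^ 2 + V₂ s t ^ 2))
    (hid : ∀ s t, c₂ s t + a s t * c₁ s t + N s t * (4 * p s t + N s t) = 0)
    (hdisc : ∀ s t, (4 * p s t + N s t) ^ 2 + 4 * a s t * c₁ s t ≤ 0)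
    (hconst : ¬ ∃ w₁ w₂ w₃ : ℝ, ∀ s t,
      V₁ s t = w₁ * a s t ∧ V₂ s t = w₂ * a s t ∧ V₃ s t = w₃ * a s t) : False := by
  have hR : 0 < R := hr.trans hrR
  have hκ : 0 < R ^ 2 - r ^ 2 := by nlinarith
  have hu0 : 0 < u₀ := by rw [hu]; positivity
  have hρ0 : 0 < x₀ ^ 2 + y₀ ^ 2 := by
    by_contra! hle
    have : x₀ ^ 2 + y₀ ^ 2 = 0 := le_antisymm hle (by positivity)
    rw [this] at hT
    nlinarith [pow_pos hu0 2]
  have hpq : IsBinaryQuadratic p := by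
    have := ((hV₁.const_mul x₀).add (hV₂.const_mul y₀)).add (hV₃.const_mul z₀)
    simpa only [← hp] using this
  -- The constant σ records the sign of the definite form a. It scales the targets below so that a =
  -- σ is an attainable value.
  obtain ⟨σ, l, δ, hσ, hδ, hσa⟩ := ha.exists_pos_mul_of_ne_zero hane
  have hσpos : ∀ s t, (s, t) ≠ 0 → 0 < σ * a s t := fun s t hst =>
    lt_of_le_of_ne (by rw [hσa]; positivity) (mul_ne_zero hσ (hane s t hst)).symm
  -- At S = P + V/a the quotient m/a is the value of u, so the torus equation makes m/(2Ra) the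
  -- distance of S from the axis, up to sign.
  obtain ⟨m, hm⟩ : ∃ m : ℝ → ℝ → ℝ, ∀ s t, m s t = u₀ * a s t + 2 * p s t + N s t :=
    ⟨_, fun _ _ => rfl⟩
  have hmq : IsBinaryQuadratic m := by
    have := ((ha.const_mul u₀).add (hpq.const_mul 2)).add hN
    simpa only [← hm] using this
  have ham : ∀ s t, a s t * m s t = (a s t * x₀ + V₁ s t) ^ 2 + (a s t * y₀ + V₂ s t) ^ 2 +
      (a s t * z₀ + V₃ s t) ^ 2 + (R ^ 2 - r ^ 2) * a s t ^ 2 := by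
    intro s t
    rw [hm, hu, hp]
    linear_combination -haN s t
  have hmn : ∀ s t, (a s t * x₀ + V₁ s t) ^ 2 + (a s t * y₀ + V₂ s t) ^ 2 =
      ((2 * R)⁻¹ * m s t) ^ 2 := by
    intro s t
    have h4 : 4 * R ^ 2 * ((a s t * x₀ + V₁ s t) ^ 2 + (a s t * y₀ + V₂ s t) ^ 2) = m s t ^ 2 := by
      rw [hm]
      linear_combination -(a s t ^ 2) * hT - hid s t + hc₂ s t + a s t * hc₁ s t -
        8 * R ^ 2 * a s t * he s t
    rw [mul_pow, ← h4]
    field_simp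
    norm_num
  have hmne : ∀ s t, (s, t) ≠ 0 → (2 * R)⁻¹ * m s t ≠ 0 := by
    intro s t hst h0
    have h0' : m s t = 0 := (mul_eq_zero.1 h0).resolve_left (by positivity)
    have h1 := ham s t
    have h2 : 0 < a s t ^ 2 := by have := hane s t hst; positivity
    rw [h0', mul_zero] at h1
    have h3 : 0 < (R ^ 2 - r ^ 2) * a s t ^ 2 := by positivity
    linarith [sq_nonneg (a s t * x₀ + V₁ s t), sq_nonneg (a s t * y₀ + V₂ s t),
      sq_nonneg (a s t * z₀ + V₃ s t)]
  -- the meridian half plane of the point of the circle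
  have hkabs : ∀ s t, ((2 * R)⁻¹ * m s t + -R * a s t) ^ 2 + (z₀ * a s t + V₃ s t) ^ 2 =
      (r * a s t) ^ 2 := by
    intro s t
    have h1 : (2 * R)⁻¹ * m s t * (R * a s t) = a s t * m s t / 2 := by field_simp
    linear_combination -hmn s t - 2 * h1 - ham s t
  obtain ⟨ρ, hρ⟩ : ∃ ρ, ρ = u₀ / (2 * R) := ⟨_, rfl⟩
  have hρu : u₀ = 2 * R * ρ := by rw [hρ]; field_simp
  have hρsq : ρ ^ 2 = x₀ ^ 2 + y₀ ^ 2 := by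
    rw [hρ, div_pow, hT]; field_simp; norm_num
  have hmer : (R - ρ) ^ 2 + z₀ ^ 2 = r ^ 2 := by linear_combination -hu + hρu + hρsq
  rcases IsBinaryQuadratic.const_or_surjective
      ((hmq.const_mul (2 * R)⁻¹).add (ha.const_mul (-R))) ((ha.const_mul z₀).add hV₃)
      (ha.const_mul r) (fun s t hst => mul_ne_zero hr.ne' (hane s t hst)) hkabs
    with ⟨α, β, hαβ⟩ | hsurj
  · have hma : ∀ s t, (2 * R)⁻¹ * m s t = (α * r + R) * a s t := fun s t => by
      linear_combination (hαβ s t).1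
    rcases IsBinaryQuadratic.const_or_surjective ((ha.const_mul x₀).add hV₁)
        ((ha.const_mul y₀).add hV₂) (hmq.const_mul (2 * R)⁻¹) hmne
        (fun s t => by rw [← hmn]; ring) with ⟨α', β', hαβ'⟩ | hsurj
    · refine hconst ⟨α' * (α * r + R) - x₀, β' * (α * r + R) - y₀, β * r - z₀, fun s t => ?_⟩
      obtain ⟨h1, h2⟩ := hαβ' s t
      rw [hma] at h1 h2
      exact ⟨by linear_combination h1, by linear_combination h2,
        by linear_combination (hαβ s t).2⟩
    -- This S has longitude opposite to that of P.
    · obtain ⟨s, t, hx, hy⟩ := hsurj (-σ * x₀) (-σ * y₀)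
      have hst : (s, t) ≠ 0 := by
        intro h0
        obtain ⟨rfl, rfl⟩ : s = 0 ∧ t = 0 := by simpa using h0
        obtain ⟨_, _, _, h1⟩ := (ha.const_mul x₀).add hV₁
        obtain ⟨_, _, _, h2⟩ := (ha.const_mul y₀).add hV₂
        have hx' : x₀ * a 0 0 + V₁ 0 0 = _ := h1 0 0
        have hy' : y₀ * a 0 0 + V₂ 0 0 = _ := h2 0 0
        rw [hx] at hx'
        rw [hy] at hy'
        have h3 : x₀ = 0 := by simpa [hσ] using hx'
        have h4 : y₀ = 0 := by simpa [hσ] using hy'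
        rw [h3, h4] at hρ0
        norm_num at hρ0
      have hapos := hσpos s t hst
      have hane' := hane s t hst
      have hsum : a s t + σ ≠ 0 := by
        intro h0
        rw [eq_neg_of_add_eq_zero_right h0] at hapos
        nlinarith [sq_nonneg (a s t)]
      generalize hA : a s t = A at *
      generalize hV1 : V₁ s t = v₁ at *
      generalize hV2 : V₂ s t = v₂ at *
      generalize hV3 : V₃ s t = v₃ at *
      -- The point P + νV is where the line PS meets the axis; 0 < νA < 1 puts it strictly between P
      -- and S.
      obtain ⟨ν, hν⟩ : ∃ ν, ν * (A + σ) = 1 := ⟨(A + σ)⁻¹, inv_mul_cancel₀ hsum⟩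
      have h1 : x₀ + ν * v₁ = 0 := by
        linear_combination ν * hx - x₀ * hν
      have h2 : y₀ + ν * v₂ = 0 := by
        linear_combination ν * hy - y₀ * hν
      have hνσ : 0 < ν * σ * (ν * A) := by
        have : ν ≠ 0 := left_ne_zero_of_mul_eq_one hν
        have : 0 < ν ^ 2 := by positivity
        nlinarith
      have hνA : ν * σ * (ν * A) = (1 - ν * A) * (ν * A) := by linear_combination ν * A * hν
      have hid' := hid s t
      have hdisc' := hdisc s t
      have hNn := haN s t
      rw [hV1, hV2, hV3, hA] at hNn
      rw [hc₂, hc₁, he, hp] at hid'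
      rw [hc₁, he, hp] at hdisc'
      rw [hV1, hV2, hV3, hA] at hid' hdisc'
      generalize N s t = n at *
      generalize hP : x₀ * v₁ + y₀ * v₂ + z₀ * v₃ = π at *
      generalize hE : x₀ * v₁ + y₀ * v₂ = ε at *
      -- The left side is T at the axis point; the right side is the factorization of T along the
      -- line, with the roots 0 and 1/A split off.
      have hkey : ((z₀ + ν * v₃) ^ 2 + (R ^ 2 - r ^ 2)) ^ 2 =
          ν * (ν * A - 1) * (n ^ 2 * (ν ^ 2 * A) + n * (4 * π + n) * ν -
            (4 * u₀ * π - 8 * R ^ 2 * ε)) := by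
        have e1 : (z₀ + ν * v₃) ^ 2 + (R ^ 2 - r ^ 2) = u₀ + 2 * ν * π + ν ^ 2 * (A * n) := by
          linear_combination -hu - (x₀ + ν * v₁) * h1 - (y₀ + ν * v₂) * h2 + 2 * ν * hP +
            2 * ν * hE + ν ^ 2 * hNn
        have e2 : x₀ ^ 2 + y₀ ^ 2 + 2 * ν * ε + ν ^ 2 * (v₁ ^ 2 + v₂ ^ 2) = 0 := by
          linear_combination (x₀ + ν * v₁) * h1 + (y₀ + ν * v₂) * h2 - 2 * ν * hE
        rw [e1]
        linear_combination hT + ν ^ 2 * hid' + 4 * R ^ 2 * e2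
      -- Completing the square: nonpositive discriminant keeps the remaining quadratic from taking
      -- the sign opposite to A.
      have hbr : 0 ≤ A * (n ^ 2 * (ν ^ 2 * A) + n * (4 * π + n) * ν -
          (4 * u₀ * π - 8 * R ^ 2 * ε)) := by
        linarith [sq_nonneg (2 * n * ν * A + (4 * π + n))]
      have hA2 : 0 < A ^ 2 := by positivity
      have hTpos : 0 < ((z₀ + ν * v₃) ^ 2 + (R ^ 2 - r ^ 2)) ^ 2 := by positivity
      have hle := mul_nonneg hνσ.le hbr
      have heq : A ^ 2 * ((z₀ + ν * v₃) ^ 2 + (R ^ 2 - r ^ 2)) ^ 2 = -(ν * σ * (ν * A) *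
          (A * (n ^ 2 * (ν ^ 2 * A) + n * (4 * π + n) * ν -
          (4 * u₀ * π - 8 * R ^ 2 * ε)))) := by
        rw [hkey, hνA]
        ring
      linarith [mul_pos hA2 hTpos]
  -- In its meridian half plane P has coordinates (ρ - R, z₀) relative to the centre of the circle.
  -- The target is the mirror image (R - ρ, z₀), so V becomes horizontal.
  · obtain ⟨s, t, hx, hy⟩ := hsurj (σ * (R - ρ)) (σ * z₀)
    have habs := hkabs s t
    rw [hx, hy] at habs
    have hst : (s, t) ≠ 0 := by
      intro h0
      obtain ⟨rfl, rfl⟩ : s = 0 ∧ t = 0 := by simpa using h0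
      have h00 : a 0 0 = 0 := by
        obtain ⟨_, _, _, h⟩ := ha
        simp [h]
      rw [h00] at habs
      have : σ ^ 2 * r ^ 2 = 0 := by linear_combination habs - σ ^ 2 * hmer
      have : 0 < σ ^ 2 * r ^ 2 := by positivity
      linarith
    have hsq : a s t ^ 2 = σ ^ 2 := by
      have : 0 < r ^ 2 := by positivity
      apply mul_left_cancel₀ this.ne'
      linear_combination -habs + σ ^ 2 * hmer
    have hA : a s t = σ := by
      rcases sq_eq_sq_iff_eq_or_eq_neg.1 hsq with h | h
      · exact h
      · have := hσpos s t hst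
        rw [h] at this
        nlinarith [sq_nonneg σ]
    have hV3 : V₃ s t = 0 := by rw [hA] at hy; linarith
    have hsum : 2 * p s t + N s t = σ * (4 * R ^ 2 - 4 * R * ρ) := by
      have h1 : m s t = 2 * R * (σ * (R - ρ) + R * σ) := by
        have : (2 * R)⁻¹ * m s t = σ * (R - ρ) + R * σ := by rw [← hx, hA]; ring
        rw [← this]; field_simp
      rw [hm, hA] at h1
      linear_combination h1 - σ * hρu
    have hpe : p s t = e s t := by rw [hp, he, hV3]; ring
    have hd := hdisc s t
    have hpos : 0 < N s t ^ 2 := by have := hNne s t hst; positivity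
    have : (4 * p s t + N s t) ^ 2 + 4 * a s t * c₁ s t = N s t ^ 2 := by
      rw [hA, hc₁, ← hpe]
      linear_combination 8 * p s t * hsum + 16 * σ * p s t * hρu
    linarith

/-! ### Polynomials along lines through a point; homogenization -/

section
open Polynomial

theorem exists_expansion_along {ι : Type*} [Fintype ι] [DecidableEq ι] (P : ι → ℝ)
    (v : ι → ℝ[X]) (f : MvPolynomial ι ℝ) :
    ∃ g : ℝ[X][X], (∀ s τ, MvPolynomial.eval (fun i => P i + τ * (v i).eval s) f =
        MvPolynomial.eval P f + τ * evalEval s τ g) ∧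
      g.coeff 0 = ∑ i, C (MvPolynomial.eval P (MvPolynomial.pderiv i f)) * v i := by
  induction f using MvPolynomial.induction_on with
  | C a => exact ⟨0, by simp, by simp⟩
  | add f f' hf hf' =>
    obtain ⟨g, h1, h2⟩ := hf
    obtain ⟨g', h1', h2'⟩ := hf'
    refine ⟨g + g', fun s τ => ?_, ?_⟩
    · rw [map_add, map_add, h1, h1', evalEval_add]; ring
    · simp only [coeff_add, h2, h2', map_add, add_mul, Finset.sum_add_distrib]
  | mul_X f j hf =>
    obtain ⟨g, h1, h2⟩ := hf
    refine ⟨C (C (MvPolynomial.eval P f) * v j) + C (C (P j)) * g + X * (g * C (v j)),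
      fun s τ => ?_, ?_⟩
    · rw [map_mul, map_mul, h1]
      simp only [MvPolynomial.eval_X, evalEval_add, evalEval_mul, evalEval_C, evalEval_X,
        eval_mul, eval_C]
      ring
    · simp only [coeff_add, coeff_C_zero, h2, mul_coeff_zero, coeff_X_zero, zero_mul,
        add_zero, Derivation.leibniz, MvPolynomial.pderiv_X, smul_eq_mul, map_add, map_mul,
        MvPolynomial.eval_X, add_mul, Finset.sum_add_distrib, Finset.mul_sum, mul_assoc]
      congr 1
      rw [Finset.sum_eq_single j]
      · simp
      · intro i _ hij
        simp [hij.symm]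
      · simp

/-- The hypotheses kill all coefficients of T along the complex direction v. This is what makes the
cubic primitive. Lagrange's identity for (x₀, y₀) and (v₁, v₂) first removes the tangential part
x₀v₂ - y₀v₁; the meridian circle equation then gives ρ²r²v₃² = 0. -/
theorem torus_no_complex_line {R r x₀ y₀ z₀ u₀ : ℝ} (hr : r ≠ 0) (hR : R ≠ 0) (hu0 : u₀ ≠ 0)
    (hu : u₀ = x₀ ^ 2 + y₀ ^ 2 + z₀ ^ 2 + (R ^ 2 - r ^ 2))
    (hT : u₀ ^ 2 = 4 * R ^ 2 * (x₀ ^ 2 + y₀ ^ 2)) {v₁ v₂ v₃ : ℂ}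
    (hN : v₁ ^ 2 + v₂ ^ 2 + v₃ ^ 2 = 0)
    (h₁ : 4 * u₀ * (x₀ * v₁ + y₀ * v₂ + z₀ * v₃) - 8 * R ^ 2 * (x₀ * v₁ + y₀ * v₂) = 0)
    (h₂ : 4 * (x₀ * v₁ + y₀ * v₂ + z₀ * v₃) ^ 2 - 4 * R ^ 2 * (v₁ ^ 2 + v₂ ^ 2) = 0) :
    v₁ = 0 ∧ v₂ = 0 ∧ v₃ = 0 := by
  obtain ⟨ρ, hρ⟩ : ∃ ρ, u₀ = 2 * R * ρ := ⟨u₀ / (2 * R), by field_simp⟩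
  have hρ0 : ρ ≠ 0 := by rintro rfl; simp [hρ] at hu0
  have hρsq : ρ ^ 2 = x₀ ^ 2 + y₀ ^ 2 := by
    have : 4 * R ^ 2 ≠ 0 := by positivity
    apply mul_left_cancel₀ this
    rw [← hT, hρ]; ring
  have hmer : (R - ρ) ^ 2 + z₀ ^ 2 = r ^ 2 := by linear_combination -hu + hρ + hρsq
  have cρ : (u₀ : ℂ) = 2 * R * ρ := by exact_mod_cast hρ
  have cρsq : (ρ : ℂ) ^ 2 = x₀ ^ 2 + y₀ ^ 2 := by exact_mod_cast hρsq
  have cmer : ((R : ℂ) - ρ) ^ 2 + z₀ ^ 2 = r ^ 2 := by exact_mod_cast hmer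
  have cR : (R : ℂ) ≠ 0 := by exact_mod_cast hR
  have cr : (r : ℂ) ≠ 0 := by exact_mod_cast hr
  have cρ0 : (ρ : ℂ) ≠ 0 := by exact_mod_cast hρ0
  obtain ⟨e, he⟩ : ∃ e, e = x₀ * v₁ + y₀ * v₂ := ⟨_, rfl⟩
  rw [← he] at h₁ h₂
  have hpe : ρ * (e + z₀ * v₃) = R * e := by
    apply mul_left_cancel₀ cR
    linear_combination h₁ / 8 - (e + z₀ * v₃) / 2 * cρ
  have he' : x₀ * v₂ - y₀ * v₁ = 0 := by
    have : (R : ℂ) ^ 2 * (x₀ * v₂ - y₀ * v₁) ^ 2 = 0 := by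
      linear_combination (ρ * (e + z₀ * v₃) + R * e) * hpe - ρ ^ 2 / 4 * h₂ -
        R ^ 2 * (v₁ ^ 2 + v₂ ^ 2) * cρsq + R ^ 2 * (e + x₀ * v₁ + y₀ * v₂) * he
    have h := (mul_eq_zero.1 this).resolve_left (pow_ne_zero _ cR)
    exact pow_eq_zero_iff (two_ne_zero) |>.1 h
  have hes : e ^ 2 = -ρ ^ 2 * v₃ ^ 2 := by
    linear_combination (e + x₀ * v₁ + y₀ * v₂) * he - (x₀ * v₂ - y₀ * v₁) * he' -
      (v₁ ^ 2 + v₂ ^ 2) * cρsq + ρ ^ 2 * hN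
  have hv₃ : v₃ = 0 := by
    have : (ρ : ℂ) ^ 2 * r ^ 2 * v₃ ^ 2 = 0 := by
      linear_combination (-ρ ^ 2 * v₃ ^ 2) * cmer + ((R - ρ) * e + ρ * z₀ * v₃) * hpe +
        (R - ρ) ^ 2 * hes
    have h := (mul_eq_zero.1 this).resolve_left (by positivity)
    exact pow_eq_zero_iff (two_ne_zero) |>.1 h
  have he0 : e = 0 := by
    rw [hv₃] at hes
    exact pow_eq_zero_iff (two_ne_zero) |>.1 (hes.trans (by ring))
  rw [he0] at he
  refine ⟨?_, ?_, hv₃⟩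
  · apply mul_left_cancel₀ (pow_ne_zero 2 cρ0)
    linear_combination v₁ * cρsq - x₀ * he - y₀ * he'
  · apply mul_left_cancel₀ (pow_ne_zero 2 cρ0)
    linear_combination v₂ * cρsq - y₀ * he + x₀ * he'

/-- Used to carry relations between polynomials in s/t over to their homogenizations at t = 0, the
parameter at infinity. -/
theorem nonpos_at_zero_of_continuous {F : ℝ → ℝ} (hF : Continuous F) (h : ∀ t, t ≠ 0 → F t ≤ 0)
    (t : ℝ) : F t ≤ 0 := by
  have hcl : IsClosed {t | F t ≤ 0} := isClosed_le hF continuous_const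
  have : closure ({0}ᶜ : Set ℝ) ⊆ {t | F t ≤ 0} := hcl.closure_subset_iff.2 fun t ht => h t ht
  rw [(dense_compl_singleton (0 : ℝ)).closure_eq] at this
  exact this (Set.mem_univ t)

theorem eq_zero_of_continuous {F : ℝ → ℝ} (hF : Continuous F) (h : ∀ t, t ≠ 0 → F t = 0)
    (t : ℝ) : F t = 0 :=
  le_antisymm (nonpos_at_zero_of_continuous hF (fun t ht => (h t ht).le) t)
    (neg_nonpos.1 (nonpos_at_zero_of_continuous hF.neg (fun t ht => by simp [h t ht]) t))

/-- The binary quadratic form obtained by homogenizing a polynomial of degree at most two. -/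
noncomputable def homogenizeTwo (f : ℝ[X]) (s t : ℝ) : ℝ :=
  f.coeff 0 * t ^ 2 + f.coeff 1 * (s * t) + f.coeff 2 * s ^ 2

theorem isBinaryQuadratic_homogenizeTwo (f : ℝ[X]) : IsBinaryQuadratic (homogenizeTwo f) :=
  ⟨_, _, _, fun _ _ => rfl⟩

theorem homogenizeTwo_eq {f : ℝ[X]} (hf : f.natDegree ≤ 2) (s : ℝ) {t : ℝ} (ht : t ≠ 0) :
    homogenizeTwo f s t = t ^ 2 * eval (s / t) f := by
  conv_rhs => rw [eq_quadratic_of_degree_le_two (natDegree_le_iff_degree_le.1 hf)]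
  simp only [homogenizeTwo, eval_add, eval_mul, eval_C, eval_X, eval_pow]
  field_simp
  ring

theorem continuous_homogenizeTwo (f : ℝ[X]) (s : ℝ) : Continuous fun t => homogenizeTwo f s t := by
  unfold homogenizeTwo
  fun_prop

end

/-! ### Quadratic curves of directions and the exceptional factorization -/

section
open Polynomial

section
variable {v₀ v₁ v₂ : Fin 3 → ℝ}

/-- The `i`-th coordinate of the quadratic parametrization `v₀ + s v₁ + s² v₂`. -/
noncomputable def quadraticCurve (v₀ v₁ v₂ : Fin 3 → ℝ) (i : Fin 3) : ℝ[X] :=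
  C (v₂ i) * X ^ 2 + C (v₁ i) * X + C (v₀ i)

theorem natDegree_quadraticCurve_le (i : Fin 3) : (quadraticCurve v₀ v₁ v₂ i).natDegree ≤ 2 :=
  natDegree_quadratic_le

theorem eval_quadraticCurve (i : Fin 3) (s : ℝ) :
    eval s (quadraticCurve v₀ v₁ v₂ i) = v₀ i + s * v₁ i + s ^ 2 * v₂ i := by
  simp only [quadraticCurve, eval_add, eval_mul, eval_C, eval_X, eval_pow]
  ring

theorem coeff_quadraticCurve (i : Fin 3) :
    (quadraticCurve v₀ v₁ v₂ i).coeff 0 = v₀ i ∧ (quadraticCurve v₀ v₁ v₂ i).coeff 1 = v₁ i ∧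
      (quadraticCurve v₀ v₁ v₂ i).coeff 2 = v₂ i := by
  simp [quadraticCurve, coeff_X, coeff_C]

theorem homogenizeTwo_quadraticCurve (i : Fin 3) (s t : ℝ) :
    homogenizeTwo (quadraticCurve v₀ v₁ v₂ i) s t =
      v₀ i * t ^ 2 + v₁ i * (s * t) + v₂ i * s ^ 2 := by
  obtain ⟨h0, h1, h2⟩ := coeff_quadraticCurve (v₀ := v₀) (v₁ := v₁) (v₂ := v₂) i
  rw [homogenizeTwo, h0, h1, h2]

/-- The field K is general because V(s) ≠ 0 is needed at complex parameters as well as real ones. -/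
theorem eq_zero_of_combination_eq_zero (hv : (Matrix.of ![v₀, v₁, v₂]).det ≠ 0) {K : Type*}
    [Field K] [Algebra ℝ K] {a b c : K}
    (h : ∀ i, a * algebraMap ℝ K (v₀ i) + b * algebraMap ℝ K (v₁ i) +
      c * algebraMap ℝ K (v₂ i) = 0) : a = 0 ∧ b = 0 ∧ c = 0 := by
  have hdet : ((Matrix.of ![v₀, v₁, v₂]).map (algebraMap ℝ K)).det ≠ 0 := by
    rw [← RingHom.mapMatrix_apply, ← RingHom.map_det]
    exact (_root_.map_ne_zero _).2 hv
  have := Matrix.eq_zero_of_vecMul_eq_zero hdet (v := ![a, b, c]) (by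
    funext i
    simpa [Matrix.vecMul, dotProduct, Fin.sum_univ_three] using h i)
  exact ⟨congrFun this 0, congrFun this 1, congrFun this 2⟩

theorem eq_zero_of_pairing_eq_zero (hv : (Matrix.of ![v₀, v₁, v₂]).det ≠ 0) {w : Fin 3 → ℝ}
    (h₀ : ∑ i, w i * v₀ i = 0) (h₁ : ∑ i, w i * v₁ i = 0) (h₂ : ∑ i, w i * v₂ i = 0) : w = 0 := by
  apply Matrix.eq_zero_of_mulVec_eq_zero hv
  funext i
  fin_cases i
  · simpa [Matrix.mulVec, dotProduct, mul_comm] using h₀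
  · simpa [Matrix.mulVec, dotProduct, mul_comm] using h₁
  · simpa [Matrix.mulVec, dotProduct, mul_comm] using h₂

/-- The exceptional factorization of the restriction of the torus to the lines through `P`
cannot occur. -/
theorem torus_no_exceptional_factor {R r x₀ y₀ z₀ u₀ : ℝ} (hr : 0 < r) (hrR : r < R)
    (hu : u₀ = x₀ ^ 2 + y₀ ^ 2 + z₀ ^ 2 + (R ^ 2 - r ^ 2))
    (hT : u₀ ^ 2 = 4 * R ^ 2 * (x₀ ^ 2 + y₀ ^ 2)) (hv : (Matrix.of ![v₀, v₁, v₂]).det ≠ 0)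
    {V : Fin 3 → ℝ[X]} (hV : V = quadraticCurve v₀ v₁ v₂)
    {e p N h c₁ : ℝ[X]} (he : e = C x₀ * V 0 + C y₀ * V 1)
    (hp : p = C x₀ * V 0 + C y₀ * V 1 + C z₀ * V 2)
    (hh : h = V 0 ^ 2 + V 1 ^ 2) (hN : N = V 0 ^ 2 + V 1 ^ 2 + V 2 ^ 2)
    (hc₁ : c₁ = C (4 * u₀) * p - C (8 * R ^ 2) * e)
    (hNne : ∀ s, eval s N ≠ 0) (hNd : N.natDegree ≤ 4)
    {a a' b' : ℝ[X]} (ha : a.natDegree = 2) (h4 : N ^ 2 = a * a')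
    (h3 : C 4 * p * N = a * b' - a')
    (h2 : C 4 * p ^ 2 + C (2 * u₀) * N - C (4 * R ^ 2) * h = -(a * c₁) - b')
    (hdisc : ∀ s, eval s b' ^ 2 + 4 * eval s a' * eval s c₁ ≤ 0) : False := by
  have ha0 : a ≠ 0 := by rintro rfl; simp at ha
  have hroot : ∀ s, eval s a ≠ 0 := fun s hs => hNne s (by
    have := congrArg (eval s) h4
    rw [eval_mul, hs, zero_mul, eval_pow] at this
    exact pow_eq_zero_iff two_ne_zero |>.1 this)
  -- A real quadratic without real zeros is prime, so from a ∣ N² it divides N itself; this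
  -- determines a' and b'.
  have hirr : Irreducible a :=
    irreducible_of_degree_le_three_of_not_isRoot (by rw [ha]; decide) hroot
  obtain ⟨n, hn⟩ : a ∣ N := hirr.prime.dvd_of_dvd_pow ⟨a', h4⟩
  have hN0 : N ≠ 0 := by rintro rfl; simpa using hNne 0
  have hn0 : n ≠ 0 := by rintro rfl; exact hN0 (by simpa using hn)
  have hnd : n.natDegree ≤ 2 := by
    rw [hn, natDegree_mul ha0 hn0, ha] at hNd
    omega
  have ha' : a' = a * n ^ 2 := by
    apply mul_left_cancel₀ ha0
    rw [← h4, hn]; ring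
  have hb' : b' = C 4 * p * n + n ^ 2 := by
    apply mul_left_cancel₀ ha0
    rw [ha', hn] at h3
    linear_combination -h3
  have hVd : ∀ i, (V i).natDegree ≤ 2 := fun i => by rw [hV]; exact natDegree_quadraticCurve_le i
  have hVt : ∀ i s t, t ≠ 0 → homogenizeTwo (V i) s t = t ^ 2 * eval (s / t) (V i) :=
    fun i s t ht => homogenizeTwo_eq (hVd i) s ht
  have hat : ∀ s t, t ≠ 0 → homogenizeTwo a s t = t ^ 2 * eval (s / t) a :=
    fun s t ht => homogenizeTwo_eq ha.le s ht
  have hnt : ∀ s t, t ≠ 0 → homogenizeTwo n s t = t ^ 2 * eval (s / t) n :=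
    fun s t ht => homogenizeTwo_eq hnd s ht
  have hVq : ∀ i, IsBinaryQuadratic (homogenizeTwo (V i)) :=
    fun i => isBinaryQuadratic_homogenizeTwo _
  have hVc : ∀ i s, Continuous fun t => homogenizeTwo (V i) s t :=
    fun i s => continuous_homogenizeTwo _ s
  have hac : ∀ s, Continuous fun t => homogenizeTwo a s t := continuous_homogenizeTwo _
  have hnc : ∀ s, Continuous fun t => homogenizeTwo n s t := continuous_homogenizeTwo _
  have hVne : ∀ s t, (s, t) ≠ 0 → homogenizeTwo (V 0) s t ^ 2 + homogenizeTwo (V 1) s t ^ 2 +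
      homogenizeTwo (V 2) s t ^ 2 ≠ 0 := by
    intro s t hst h0
    have hz : ∀ i, homogenizeTwo (V i) s t = 0 := by
      intro i
      fin_cases i
      all_goals
        apply pow_eq_zero_iff two_ne_zero |>.1
        have := sq_nonneg (homogenizeTwo (V 0) s t)
        have := sq_nonneg (homogenizeTwo (V 1) s t)
        have := sq_nonneg (homogenizeTwo (V 2) s t)
        simp only [Fin.zero_eta, Fin.mk_one, Fin.reduceFinMk]
        linarith
    obtain ⟨h1, -, h2⟩ := eq_zero_of_combination_eq_zero (K := ℝ) hv (a := t ^ 2) (b := s * t)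
      (c := s ^ 2) (fun i => by
        have := hz i
        rw [hV, homogenizeTwo_quadraticCurve] at this
        simp only [Algebra.algebraMap_self, RingHom.id_apply]
        linarith)
    exact hst (Prod.ext (pow_eq_zero_iff two_ne_zero |>.1 h2) (pow_eq_zero_iff two_ne_zero |>.1 h1))
  have haN : ∀ s t, homogenizeTwo (V 0) s t ^ 2 + homogenizeTwo (V 1) s t ^ 2 +
      homogenizeTwo (V 2) s t ^ 2 = homogenizeTwo a s t * homogenizeTwo n s t := by
    intro s t
    rw [← sub_eq_zero]
    refine eq_zero_of_continuous (F := fun t => homogenizeTwo (V 0) s t ^ 2 +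
      homogenizeTwo (V 1) s t ^ 2 + homogenizeTwo (V 2) s t ^ 2 -
      homogenizeTwo a s t * homogenizeTwo n s t) ?_ (fun t ht => ?_) t
    · exact ((((hVc 0 s).pow 2).add ((hVc 1 s).pow 2)).add ((hVc 2 s).pow 2)).sub
        ((hac s).mul (hnc s))
    · have := congrArg (eval (s / t)) (hN.symm.trans hn)
      simp only [eval_add, eval_mul, eval_pow] at this
      simp only [hVt _ s t ht, hat s t ht, hnt s t ht]
      linear_combination t ^ 4 * this
  refine torus_circle_discrim_pos hr hrR hu hT (hVq 0) (hVq 1) (hVq 2)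
    (isBinaryQuadratic_homogenizeTwo a) (isBinaryQuadratic_homogenizeTwo n)
    (fun s t hst h0 => hVne s t hst (by rw [haN, h0, zero_mul]))
    (fun s t hst h0 => hVne s t hst (by rw [haN, h0, mul_zero])) haN
    (fun _ _ => rfl) (fun _ _ => rfl) (fun _ _ => rfl) (fun _ _ => rfl) ?_ ?_ ?_
  · intro s t
    refine eq_zero_of_continuous (F := fun t => 4 * (x₀ * homogenizeTwo (V 0) s t +
      y₀ * homogenizeTwo (V 1) s t + z₀ * homogenizeTwo (V 2) s t) ^ 2 +
      2 * u₀ * (homogenizeTwo a s t * homogenizeTwo n s t) -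
      4 * R ^ 2 * (homogenizeTwo (V 0) s t ^ 2 + homogenizeTwo (V 1) s t ^ 2) +
      homogenizeTwo a s t * (4 * u₀ * (x₀ * homogenizeTwo (V 0) s t +
      y₀ * homogenizeTwo (V 1) s t + z₀ * homogenizeTwo (V 2) s t) - 8 * R ^ 2 *
      (x₀ * homogenizeTwo (V 0) s t + y₀ * homogenizeTwo (V 1) s t)) +
      homogenizeTwo n s t * (4 * (x₀ * homogenizeTwo (V 0) s t +
      y₀ * homogenizeTwo (V 1) s t + z₀ * homogenizeTwo (V 2) s t) + homogenizeTwo n s t))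
      ?_ (fun t ht => ?_) t
    · have := hVc 0 s
      have := hVc 1 s
      have := hVc 2 s
      have := hac s
      have := hnc s
      fun_prop
    · rw [hb', hc₁, hn, hh, he, hp] at h2
      have := congrArg (eval (s / t)) h2
      simp only [eval_add, eval_sub, eval_neg, eval_mul, eval_pow, eval_C] at this
      simp only [hVt _ s t ht, hat s t ht, hnt s t ht]
      linear_combination t ^ 4 * this
  · intro s t
    refine nonpos_at_zero_of_continuous (F := fun t => (4 * (x₀ * homogenizeTwo (V 0) s t +
      y₀ * homogenizeTwo (V 1) s t + z₀ * homogenizeTwo (V 2) s t) + homogenizeTwo n s t) ^ 2 +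
      4 * homogenizeTwo a s t * (4 * u₀ * (x₀ * homogenizeTwo (V 0) s t +
      y₀ * homogenizeTwo (V 1) s t + z₀ * homogenizeTwo (V 2) s t) - 8 * R ^ 2 *
      (x₀ * homogenizeTwo (V 0) s t + y₀ * homogenizeTwo (V 1) s t)))
      ?_ (fun t ht => ?_) t
    · have := hVc 0 s
      have := hVc 1 s
      have := hVc 2 s
      have := hac s
      have := hnc s
      fun_prop
    · have hd := hdisc (s / t)
      have hnn : eval (s / t) n ≠ 0 := fun h0 => hNne (s / t) (by rw [hn, eval_mul, h0, mul_zero])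
      rw [hb', ha', hc₁, he, hp] at hd
      simp only [eval_add, eval_sub, eval_mul, eval_pow, eval_C] at hd
      simp only [hVt _ s t ht, hat s t ht, hnt s t ht]
      have hn2 : 0 < eval (s / t) n ^ 2 := by positivity
      have ht4 : 0 ≤ t ^ 4 := by positivity
      refine le_of_mul_le_mul_left ?_ hn2
      rw [mul_zero]
      have := mul_nonpos_of_nonneg_of_nonpos ht4 hd
      linarith
  -- If V were a fixed vector times a, then v₀ and v₂ would be parallel.
  · rintro ⟨w₁, w₂, w₃, hw⟩
    have hcoef : ∀ i, ∃ w, ∀ s t, homogenizeTwo (V i) s t = w * homogenizeTwo a s t := by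
      intro i
      fin_cases i
      · exact ⟨w₁, fun s t => (hw s t).1⟩
      · exact ⟨w₂, fun s t => (hw s t).2.1⟩
      · exact ⟨w₃, fun s t => (hw s t).2.2⟩
    choose w hw using hcoef
    have e0 : ∀ i, v₀ i = w i * a.coeff 0 := fun i => by
      have := hw i 0 1
      rw [hV, homogenizeTwo_quadraticCurve] at this
      simpa [homogenizeTwo] using this
    have e2 : ∀ i, v₂ i = w i * a.coeff 2 := fun i => by
      have := hw i 1 0
      rw [hV, homogenizeTwo_quadraticCurve] at this
      simpa [homogenizeTwo] using this
    apply hv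
    rw [Matrix.det_fin_three]
    simp [e0, e2]
    ring

end

end

/-! ### Gradients at P of polynomials vanishing on the curve -/

section
open Polynomial

theorem eval_torusPoly (R r : ℝ) (p : Fin 3 → ℝ) :
    MvPolynomial.eval p (TorusQuadric.torusPoly R r) =
      (p 0 ^ 2 + p 1 ^ 2 + p 2 ^ 2 + (R ^ 2 - r ^ 2)) ^ 2 - 4 * R ^ 2 * (p 0 ^ 2 + p 1 ^ 2) := by
  simp only [TorusQuadric.torusPoly, TorusQuadric.p2, TorusQuadric.p0, map_add, map_sub, map_mul,
    map_pow, MvPolynomial.eval_X, MvPolynomial.eval_C]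
  ring

/-- The gradient of the torus polynomial. -/
def torusGradient (R r : ℝ) (P : Fin 3 → ℝ) : Fin 3 → ℝ :=
  ![4 * P 0 * (P 0 ^ 2 + P 1 ^ 2 + P 2 ^ 2 + (R ^ 2 - r ^ 2) - 2 * R ^ 2),
    4 * P 1 * (P 0 ^ 2 + P 1 ^ 2 + P 2 ^ 2 + (R ^ 2 - r ^ 2) - 2 * R ^ 2),
    4 * P 2 * (P 0 ^ 2 + P 1 ^ 2 + P 2 ^ 2 + (R ^ 2 - r ^ 2))]

/-- For r < R the quantity u is positive, so a zero gradient forces z = 0 and u = 2R², and the torus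
equation then forces r = 0. -/
theorem torusGradient_ne_zero {R r : ℝ} {P : Fin 3 → ℝ} (hr : 0 < r) (hrR : r < R)
    (hT : (P 0 ^ 2 + P 1 ^ 2 + P 2 ^ 2 + (R ^ 2 - r ^ 2)) ^ 2 =
      4 * R ^ 2 * (P 0 ^ 2 + P 1 ^ 2)) : torusGradient R r P ≠ 0 := by
  intro h
  have hκ : 0 < R ^ 2 - r ^ 2 := by nlinarith
  have hu0 : 0 < P 0 ^ 2 + P 1 ^ 2 + P 2 ^ 2 + (R ^ 2 - r ^ 2) := by positivity
  have h0 := congrFun h 0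
  have h1 := congrFun h 1
  have h2 := congrFun h 2
  simp only [torusGradient, Matrix.cons_val, Pi.zero_apply] at h0 h1 h2
  generalize hu : P 0 ^ 2 + P 1 ^ 2 + P 2 ^ 2 + (R ^ 2 - r ^ 2) = u at *
  have hz : P 2 = 0 := by
    have := (mul_eq_zero.1 h2).resolve_right hu0.ne'
    linarith
  have hprod : u ^ 2 * (u - 2 * R ^ 2) = 0 := by
    rw [hT]
    linear_combination R ^ 2 * P 0 * h0 + R ^ 2 * P 1 * h1
  have hu2 : u = 2 * R ^ 2 := by
    have := (mul_eq_zero.1 hprod).resolve_left (by positivity)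
    linarith
  have hR : 0 < R := hr.trans hrR
  have : 4 * R ^ 2 * r ^ 2 = 0 := by
    rw [hu2] at hT hu
    rw [hz] at hu
    linear_combination -hT - 4 * R ^ 2 * hu
  have : 0 < 4 * R ^ 2 * r ^ 2 := by positivity
  linarith

/-- A polynomial vanishing on the part of the torus swept out by the lines through `P` with
directions on a nondegenerate conic has its gradient at `P` proportional to that of the torus. -/
theorem gradient_proportional_of_vanishing {R r : ℝ} {P : Fin 3 → ℝ} (hr : 0 < r) (hrR : r < R)
    (hT : (P 0 ^ 2 + P 1 ^ 2 + P 2 ^ 2 + (R ^ 2 - r ^ 2)) ^ 2 =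
      4 * R ^ 2 * (P 0 ^ 2 + P 1 ^ 2))
    {v₀ v₁ v₂ : Fin 3 → ℝ} (hv : (Matrix.of ![v₀, v₁, v₂]).det ≠ 0)
    (hlead : ∑ i, torusGradient R r P i * v₂ i ≠ 0) {f : MvPolynomial (Fin 3) ℝ}
    (hfP : MvPolynomial.eval P f = 0)
    (hf : ∀ s τ, MvPolynomial.eval (fun i => P i + τ * (quadraticCurve v₀ v₁ v₂ i).eval s)
        (TorusQuadric.torusPoly R r) = 0 →
      MvPolynomial.eval (fun i => P i + τ * (quadraticCurve v₀ v₁ v₂ i).eval s) f = 0) :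
    ∃ k, ∀ i, MvPolynomial.eval P (MvPolynomial.pderiv i f) = k * torusGradient R r P i := by
  have hR : 0 < R := hr.trans hrR
  have hκ : 0 < R ^ 2 - r ^ 2 := by nlinarith
  obtain ⟨u₀, hu⟩ : ∃ u₀, u₀ = P 0 ^ 2 + P 1 ^ 2 + P 2 ^ 2 + (R ^ 2 - r ^ 2) := ⟨_, rfl⟩
  have hu0 : 0 < u₀ := by rw [hu]; positivity
  have hgrad : torusGradient R r P =
      ![4 * P 0 * (u₀ - 2 * R ^ 2), 4 * P 1 * (u₀ - 2 * R ^ 2), 4 * P 2 * u₀] := by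
    rw [hu]; rfl
  rw [← hu] at hT
  obtain ⟨V, hV⟩ : ∃ V, V = quadraticCurve v₀ v₁ v₂ := ⟨_, rfl⟩
  rw [← hV] at hf
  have hVd : ∀ i, (V i).natDegree ≤ 2 := fun i => by rw [hV]; exact natDegree_quadraticCurve_le i
  obtain ⟨e, he⟩ : ∃ e, e = C (P 0) * V 0 + C (P 1) * V 1 := ⟨_, rfl⟩
  obtain ⟨p, hp⟩ : ∃ p, p = C (P 0) * V 0 + C (P 1) * V 1 + C (P 2) * V 2 := ⟨_, rfl⟩
  obtain ⟨h, hh⟩ : ∃ h, h = V 0 ^ 2 + V 1 ^ 2 := ⟨_, rfl⟩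
  obtain ⟨N, hN⟩ : ∃ N, N = V 0 ^ 2 + V 1 ^ 2 + V 2 ^ 2 := ⟨_, rfl⟩
  obtain ⟨c₁, hc₁⟩ : ∃ c₁, c₁ = C (4 * u₀) * p - C (8 * R ^ 2) * e := ⟨_, rfl⟩
  obtain ⟨c₂, hc₂⟩ : ∃ c₂, c₂ = C 4 * p ^ 2 + C (2 * u₀) * N - C (4 * R ^ 2) * h := ⟨_, rfl⟩
  have hVsq : ∀ i, (V i ^ 2).natDegree ≤ 4 := fun i => by
    rw [natDegree_pow]; have := hVd i; omega
  have hCV : ∀ x i, (C x * V i).natDegree ≤ 2 := fun x i => (natDegree_C_mul_le _ _).trans (hVd i)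
  have hed : e.natDegree ≤ 2 := by
    rw [he]; exact natDegree_add_le_of_degree_le (hCV _ _) (hCV _ _)
  have hpd : p.natDegree ≤ 2 := by
    rw [hp]
    exact natDegree_add_le_of_degree_le (natDegree_add_le_of_degree_le (hCV _ _) (hCV _ _))
      (hCV _ _)
  have hhd : h.natDegree ≤ 4 := by
    rw [hh]; exact natDegree_add_le_of_degree_le (hVsq _) (hVsq _)
  have hNd : N.natDegree ≤ 4 := by
    rw [hN]
    exact natDegree_add_le_of_degree_le (natDegree_add_le_of_degree_le (hVsq _) (hVsq _)) (hVsq _)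
  have hcoeff : ∀ i, (V i).coeff 0 = v₀ i ∧ (V i).coeff 1 = v₁ i ∧ (V i).coeff 2 = v₂ i :=
    fun i => by rw [hV]; exact coeff_quadraticCurve i
  have hc₁sum : c₁ = ∑ i, C (torusGradient R r P i) * V i := by
    rw [Fin.sum_univ_three, hgrad, hc₁, he, hp]
    simp only [Matrix.cons_val, C_mul, C_sub, C_pow]
    rw [show (C 8 : ℝ[X]) = C 4 * C 2 by rw [← C_mul]; norm_num]
    ring
  -- The degree is exactly 2 because the direction v₂ at s = ∞ is not tangent to the torus.
  have hc₁d : c₁.natDegree = 2 := by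
    apply le_antisymm
    · rw [hc₁]
      exact (natDegree_sub_le _ _).trans (max_le ((natDegree_C_mul_le _ _).trans hpd)
        ((natDegree_C_mul_le _ _).trans hed))
    · apply le_natDegree_of_ne_zero
      rw [hc₁sum, finsetSum_coeff]
      simpa [coeff_C_mul, hcoeff] using hlead
  have hc₂d : c₂.natDegree ≤ 4 := by
    rw [hc₂]
    refine (natDegree_sub_le _ _).trans (max_le (natDegree_add_le_of_degree_le
      ((natDegree_C_mul_le _ _).trans ?_) ((natDegree_C_mul_le _ _).trans hNd))
      ((natDegree_C_mul_le _ _).trans hhd))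
    rw [natDegree_pow]; omega
  have hc₃d : (C 4 * p * N).natDegree ≤ 6 :=
    natDegree_mul_le.trans (add_le_add ((natDegree_C_mul_le _ _).trans hpd) hNd)
  have hNcoeff : N.coeff 4 = v₂ 0 ^ 2 + v₂ 1 ^ 2 + v₂ 2 ^ 2 := by
    have : ∀ i, (V i ^ 2).coeff 4 = v₂ i ^ 2 := fun i => by
      have := coeff_pow_of_natDegree_le (m := 2) (hVd i)
      rw [(hcoeff i).2.2] at this
      exact this
    rw [hN, coeff_add, coeff_add, this, this, this]
  have hN4 : N.natDegree = 4 := by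
    refine le_antisymm hNd (le_natDegree_of_ne_zero ?_)
    rw [hNcoeff]
    intro h0
    apply hlead
    have a0 : v₂ 0 = 0 := by nlinarith [sq_nonneg (v₂ 0), sq_nonneg (v₂ 1), sq_nonneg (v₂ 2)]
    have a1 : v₂ 1 = 0 := by nlinarith [sq_nonneg (v₂ 0), sq_nonneg (v₂ 1), sq_nonneg (v₂ 2)]
    have a2 : v₂ 2 = 0 := by nlinarith [sq_nonneg (v₂ 0), sq_nonneg (v₂ 1), sq_nonneg (v₂ 2)]
    simp [Fin.sum_univ_three, a0, a1, a2]
  have haeval : ∀ {K : Type} [Field K] [Algebra ℝ K] (z : K),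
      aeval z (V 0) = 0 → aeval z (V 1) = 0 → aeval z (V 2) = 0 → False := by
    intro K _ _ z z0 z1 z2
    have := eq_zero_of_combination_eq_zero (K := K) hv (a := 1) (b := z) (c := z ^ 2) (fun i => by
      have hz : aeval z (V i) = 0 := by
        fin_cases i
        · exact z0
        · exact z1
        · exact z2
      rw [hV, quadraticCurve] at hz
      simp only [map_add, map_mul, aeval_C, aeval_X, map_pow] at hz
      linear_combination hz)
    exact one_ne_zero this.1
  have hNne : ∀ s, eval s N ≠ 0 := by
    intro s h0
    rw [hN] at h0
    simp only [eval_add, eval_pow] at h0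
    have := sq_nonneg (eval s (V 0))
    have := sq_nonneg (eval s (V 1))
    have := sq_nonneg (eval s (V 2))
    refine haeval (K := ℝ) s ?_ ?_ ?_
    all_goals
      rw [coe_aeval_eq_eval]
      apply pow_eq_zero_iff two_ne_zero |>.1
      linarith
  -- A nonunit common factor would have a complex root z, at which V(z) satisfies the hypotheses of
  -- `torus_no_complex_line` and so vanishes, against independence.
  have hprim : (cubicPoly c₁ c₂ (C 4 * p * N) (N ^ 2)).IsPrimitive := by
    intro q hq
    have hqc := (C_dvd_iff_dvd_coeff _ _).1 hq
    by_contra hqu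
    have d1 : q ∣ c₁ := by simpa [cubicPoly] using hqc 0
    have d2 : q ∣ c₂ := by simpa [cubicPoly] using hqc 1
    have d4 : q ∣ N ^ 2 := by simpa [cubicPoly] using hqc 3
    have hq0 : q ≠ 0 := ne_zero_of_dvd_ne_zero (by rintro rfl; simp at hc₁d) d1
    obtain ⟨z, hz⟩ := IsAlgClosed.exists_aeval_eq_zero ℂ q
      (fun hd => hqu (isUnit_iff_degree_eq_zero.2 hd))
    have hroot : ∀ {c : ℝ[X]}, q ∣ c → aeval z c = 0 := by
      rintro c ⟨d, rfl⟩
      rw [map_mul, hz, zero_mul]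
    have z1 := hroot d1
    have z2 := hroot d2
    have z4 : aeval z N = 0 := by
      have := hroot d4
      rw [map_pow] at this
      exact pow_eq_zero_iff two_ne_zero |>.1 this
    rw [hc₁, he, hp] at z1
    rw [hc₂] at z2
    simp only [map_add, map_sub, map_mul, z4, mul_zero, add_zero] at z2
    rw [hp, hh] at z2
    rw [hN] at z4
    simp only [map_add, map_sub, map_mul, map_pow, aeval_C, Complex.coe_algebraMap,
      Complex.ofReal_ofNat] at z1 z2 z4
    obtain ⟨w0, w1, w2⟩ := torus_no_complex_line hr.ne' hR.ne' hu0.ne' hu hT z4 z1 z2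
    exact haeval z w0 w1 w2
  obtain ⟨g, hg, hg0⟩ := exists_expansion_along P V f
  have hexp : ∀ s τ, MvPolynomial.eval (fun i => P i + τ * (V i).eval s)
      (TorusQuadric.torusPoly R r) =
      τ * evalEval s τ (cubicPoly c₁ c₂ (C 4 * p * N) (N ^ 2)) := by
    intro s τ
    rw [eval_torusPoly, evalEval_cubicPoly, hc₁, hc₂, hh, hN, he, hp]
    simp only [eval_add, eval_sub, eval_mul, eval_pow, eval_C]
    subst hu
    linear_combination hT
  obtain ⟨q, hq⟩ : c₁ ∣ g.coeff 0 := by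
    refine coeff_zero_dvd hc₁d hc₂d hc₃d (by rw [natDegree_pow, hN4])
      (fun s => by rw [eval_pow]; exact pow_ne_zero _ (hNne s)) hprim (fun s τ hτ hG => ?_) ?_
    · have h1 := hf s τ (by rw [hexp, hG, mul_zero])
      rw [hg, hfP, zero_add] at h1
      exact (mul_eq_zero.1 h1).resolve_left hτ
    · intro a a' b' ha h4 h3 h2 hdisc
      exact torus_no_exceptional_factor hr hrR hu hT hv hV he hp hh hN hc₁ hNne hNd ha h4 h3
        (hc₂ ▸ h2) hdisc
  have hqC : q = C (q.coeff 0) := by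
    apply eq_C_of_natDegree_eq_zero
    by_cases hq0 : q = 0
    · simp [hq0]
    have hgd : (g.coeff 0).natDegree ≤ 2 := by
      rw [hg0]
      exact natDegree_sum_le_of_forall_le _ _ fun i _ => hCV _ i
    rw [hq, natDegree_mul (by rintro rfl; simp at hc₁d) hq0, hc₁d] at hgd
    omega
  refine ⟨q.coeff 0, ?_⟩
  have hsum : ∑ i, C (MvPolynomial.eval P (MvPolynomial.pderiv i f) -
      q.coeff 0 * torusGradient R r P i) * V i = 0 := by
    rw [hqC, hg0, hc₁sum] at hq
    simp only [C_sub, C_mul, sub_mul, Finset.sum_sub_distrib, hq, Finset.sum_mul]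
    rw [sub_eq_zero]
    exact Finset.sum_congr rfl fun i _ => by ring
  have hw := eq_zero_of_pairing_eq_zero hv
    (w := fun i => MvPolynomial.eval P (MvPolynomial.pderiv i f) -
      q.coeff 0 * torusGradient R r P i)
    (by simpa only [finsetSum_coeff, coeff_C_mul, hcoeff, coeff_zero] using
      congrArg (coeff · 0) hsum)
    (by simpa only [finsetSum_coeff, coeff_C_mul, hcoeff, coeff_zero] using
      congrArg (coeff · 1) hsum)
    (by simpa only [finsetSum_coeff, coeff_C_mul, hcoeff, coeff_zero] using
      congrArg (coeff · 2) hsum)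
  intro i
  exact sub_eq_zero.1 (congrFun hw i)

end

/-! ### Parametrization of the cone and conclusion -/

section
open Matrix

theorem dotProduct_mulVec_symm {M : Matrix (Fin 3) (Fin 3) ℝ} (hM : M.IsSymm) (x y : Fin 3 → ℝ) :
    x ⬝ᵥ M *ᵥ y = y ⬝ᵥ M *ᵥ x := by
  rw [dotProduct_mulVec, ← mulVec_transpose, hM.eq, dotProduct_comm]

theorem dotProduct_mulVec_combination_self {M : Matrix (Fin 3) (Fin 3) ℝ} (hM : M.IsSymm)
    (x y z : Fin 3 → ℝ) (a b c : ℝ) :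
    (a • x + b • y + c • z) ⬝ᵥ M *ᵥ (a • x + b • y + c • z) =
      a ^ 2 * (x ⬝ᵥ M *ᵥ x) + b ^ 2 * (y ⬝ᵥ M *ᵥ y) + c ^ 2 * (z ⬝ᵥ M *ᵥ z) +
        2 * a * b * (x ⬝ᵥ M *ᵥ y) + 2 * a * c * (x ⬝ᵥ M *ᵥ z) + 2 * b * c * (y ⬝ᵥ M *ᵥ z) := by
  simp only [mulVec_add, mulVec_smul, dotProduct_add, dotProduct_smul, add_dotProduct,
    smul_dotProduct, smul_eq_mul, dotProduct_mulVec_symm hM y x, dotProduct_mulVec_symm hM z x,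
    dotProduct_mulVec_symm hM z y]
  ring

theorem det_of_ne_zero_of_combination {x y z : Fin 3 → ℝ}
    (h : ∀ a b c : ℝ, a • x + b • y + c • z = 0 → a = 0 ∧ b = 0 ∧ c = 0) :
    (Matrix.of ![x, y, z]).det ≠ 0 := by
  intro hd
  obtain ⟨v, hv, hv0⟩ := exists_vecMul_eq_zero_iff.2 hd
  obtain ⟨h0, h1, h2⟩ := h (v 0) (v 1) (v 2) (by
    funext i
    have := congrFun hv0 i
    simpa [vecMul, dotProduct, Fin.sum_univ_three] using this)
  apply hv
  funext i
  fin_cases i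
  · exact h0
  · exact h1
  · exact h2

/-- A real nondegenerate conic with a real point is rationally parametrized by quadratic forms. -/
theorem exists_parametrization {M : Matrix (Fin 3) (Fin 3) ℝ} (hM : M.IsSymm) (hdet : M.det ≠ 0)
    {w : Fin 3 → ℝ} (hw : w ≠ 0) (hww : w ⬝ᵥ M *ᵥ w = 0) :
    ∃ v₀ v₁ v₂ : Fin 3 → ℝ, (Matrix.of ![v₀, v₁, v₂]).det ≠ 0 ∧ ∀ s t : ℝ,
      (t ^ 2 • v₀ + (s * t) • v₁ + s ^ 2 • v₂) ⬝ᵥ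
        M *ᵥ (t ^ 2 • v₀ + (s * t) • v₁ + s ^ 2 • v₂) = 0 := by
  have hMw : M *ᵥ w ≠ 0 := fun h => hw (eq_zero_of_mulVec_eq_zero hdet h)
  obtain ⟨y, hyw⟩ : ∃ y, y ⬝ᵥ M *ᵥ w = 1 := by
    refine ⟨((M *ᵥ w) ⬝ᵥ (M *ᵥ w))⁻¹ • (M *ᵥ w), ?_⟩
    rw [smul_dotProduct, smul_eq_mul, inv_mul_cancel₀ (mt dotProduct_self_eq_zero.1 hMw)]
  -- Subtracting a multiple of w makes y isotropic and completes w to a hyperbolic pair.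
  obtain ⟨x, hxw, hxx⟩ : ∃ x, x ⬝ᵥ M *ᵥ w = 1 ∧ x ⬝ᵥ M *ᵥ x = 0 := by
    refine ⟨y - ((y ⬝ᵥ M *ᵥ y) / 2) • w, ?_, ?_⟩
    · rw [sub_dotProduct, smul_dotProduct, hyw, hww, smul_zero, sub_zero]
    · simp only [mulVec_sub, mulVec_smul, dotProduct_sub, dotProduct_smul, sub_dotProduct,
        smul_dotProduct, smul_eq_mul, hww, hyw, dotProduct_mulVec_symm hM w y]
      ring
  have hcross : w ⨯₃ x ≠ 0 := by
    intro h0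
    have h1 : (w ⨯₃ x) ⨯₃ (M *ᵥ w) = 0 := by rw [h0]; simp
    rw [cross_cross_eq_smul_sub_smul, hww, hxw] at h1
    simp [hw] at h1
  have hunit : IsUnit M.det := hdet.isUnit
  -- This e spans the orthogonal complement of w and x for the form M.
  obtain ⟨e, he⟩ : ∃ e, M *ᵥ e = w ⨯₃ x :=
    ⟨M⁻¹ *ᵥ (w ⨯₃ x), by rw [mulVec_mulVec, mul_nonsing_inv _ hunit, one_mulVec]⟩
  have he0 : e ≠ 0 := by rintro rfl; exact hcross (by rw [← he, mulVec_zero])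
  have hwe : w ⬝ᵥ M *ᵥ e = 0 := by rw [he, dot_self_cross]
  have hxe : x ⬝ᵥ M *ᵥ e = 0 := by rw [he, dot_cross_self]
  have hbasis : ∀ a b c : ℝ, a • x + b • e + c • w = 0 → a = 0 ∧ b = 0 ∧ c = 0 := by
    intro a b c h
    have ha := congrArg (· ⬝ᵥ M *ᵥ w) h
    have hc := congrArg (· ⬝ᵥ M *ᵥ x) h
    simp only [add_dotProduct, smul_dotProduct, smul_eq_mul, zero_dotProduct, hxw, hww,
      dotProduct_mulVec_symm hM e w, hwe, hxx, dotProduct_mulVec_symm hM e x, hxe,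
      dotProduct_mulVec_symm hM w x, mul_zero, mul_one, add_zero, zero_add] at ha hc
    rw [ha, hc] at h
    simp only [zero_smul, zero_add, add_zero, smul_eq_zero, he0, or_false] at h
    exact ⟨ha, h, hc⟩
  have hee : e ⬝ᵥ M *ᵥ e ≠ 0 := by
    intro h0
    refine hcross (he ▸ eq_zero_of_mulVec_eq_zero (det_of_ne_zero_of_combination hbasis) ?_)
    funext i
    fin_cases i
    · exact hxe
    · exact h0
    · exact hwe
  -- The factor of w makes the two s²t² terms cancel.
  refine ⟨x, e, (-(e ⬝ᵥ M *ᵥ e) / 2) • w, det_of_ne_zero_of_combination ?_, fun s t => ?_⟩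
  · intro a b c h
    rw [smul_smul] at h
    obtain ⟨h1, h2, h3⟩ := hbasis _ _ _ h
    exact ⟨h1, h2, (mul_eq_zero.1 h3).resolve_right (by simpa using hee)⟩
  · rw [smul_smul, dotProduct_mulVec_combination_self hM, hxx, hww, hxe, hxw,
      dotProduct_mulVec_symm hM e w, hwe]
    ring

/-- The pairing of n with the conic is a nonzero binary quadratic form, so it is nonzero at one of
(s, t) = (1, 0), (0, 1), (1, 1). A change of parameter moves that point to s = ∞. -/
theorem exists_parametrization_transverse {M : Matrix (Fin 3) (Fin 3) ℝ} (hM : M.IsSymm)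
    (hdet : M.det ≠ 0) {w n : Fin 3 → ℝ} (hw : w ≠ 0) (hww : w ⬝ᵥ M *ᵥ w = 0) (hn : n ≠ 0) :
    ∃ v₀ v₁ v₂ : Fin 3 → ℝ, (Matrix.of ![v₀, v₁, v₂]).det ≠ 0 ∧ n ⬝ᵥ v₂ ≠ 0 ∧ ∀ s : ℝ,
      (v₀ + s • v₁ + s ^ 2 • v₂) ⬝ᵥ M *ᵥ (v₀ + s • v₁ + s ^ 2 • v₂) = 0 := by
  obtain ⟨v₀, v₁, v₂, hv, hiso⟩ := exists_parametrization hM hdet hw hww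
  by_cases h2 : n ⬝ᵥ v₂ = 0
  · by_cases h0 : n ⬝ᵥ v₀ = 0
    · have h1 : n ⬝ᵥ v₁ ≠ 0 := fun h1 => hn (eq_zero_of_pairing_eq_zero hv h0 h1 h2)
      refine ⟨v₀, (2 : ℝ) • v₀ + v₁, v₀ + v₁ + v₂, ?_, ?_, fun s => ?_⟩
      · convert hv using 1
        simp only [det_fin_three, of_apply, cons_val, Pi.add_apply, Pi.smul_apply, smul_eq_mul]
        ring
      · rwa [dotProduct_add, dotProduct_add, h0, h2, zero_add, add_zero]
      · rw [show v₀ + s • ((2 : ℝ) • v₀ + v₁) + s ^ 2 • (v₀ + v₁ + v₂) =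
          (s + 1) ^ 2 • v₀ + (s * (s + 1)) • v₁ + s ^ 2 • v₂ by module]
        exact hiso s (s + 1)
    · refine ⟨v₂, v₁, v₀, ?_, h0, fun s => ?_⟩
      · intro h
        apply hv
        rw [← neg_eq_zero, ← h]
        simp only [det_fin_three, of_apply, cons_val]
        ring
      · rw [show v₂ + s • v₁ + s ^ 2 • v₀ =
          s ^ 2 • v₀ + (1 * s) • v₁ + (1 : ℝ) ^ 2 • v₂ by module]
        exact hiso 1 s
  · refine ⟨v₀, v₁, v₂, hv, h2, fun s => ?_⟩
    have := hiso s 1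
    simpa using this

theorem eval_cone (M : Matrix (Fin 3) (Fin 3) ℝ) (P p : Fin 3 → ℝ) :
    MvPolynomial.eval p (∑ i, ∑ j, MvPolynomial.C (M i j) *
      (MvPolynomial.X i - MvPolynomial.C (P i)) * (MvPolynomial.X j - MvPolynomial.C (P j))) =
      (p - P) ⬝ᵥ M *ᵥ (p - P) := by
  simp only [map_sum, map_mul, map_sub, MvPolynomial.eval_C, MvPolynomial.eval_X, dotProduct,
    mulVec, Finset.mul_sum, Pi.sub_apply]
  refine Finset.sum_congr rfl fun i _ => Finset.sum_congr rfl fun j _ => ?_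
  ring

theorem mainTheorem12 (R r : ℝ) (hr : 0 < r) (hrR : r < R)
    (Q : MvPolynomial (Fin 3) ℝ) (P : Fin 3 → ℝ)
    (hQ : TorusQuadric.IsRealCone Q P) (hP : P ∈ TorusQuadric.torus R r) :
    TorusQuadric.IsSingularPoint (TorusQuadric.intersectionCurve R r Q) P := by
  obtain ⟨⟨M, hM, hdet, rfl⟩, w, hw, hwP⟩ := hQ
  have hT : MvPolynomial.eval P (TorusQuadric.torusPoly R r) = 0 := hP
  rw [eval_torusPoly, sub_eq_zero] at hT
  have hw' : (w - P) ⬝ᵥ M *ᵥ (w - P) = 0 := by rw [← eval_cone]; exact hw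
  obtain ⟨v₀, v₁, v₂, hv, hlead, hiso⟩ := exists_parametrization_transverse hM hdet
    (sub_ne_zero.2 hwP) hw' (torusGradient_ne_zero hr hrR hT)
  have hPC : P ∈ TorusQuadric.intersectionCurve R r (∑ i, ∑ j, MvPolynomial.C (M i j) *
      (MvPolynomial.X i - MvPolynomial.C (P i)) *
      (MvPolynomial.X j - MvPolynomial.C (P j))) := by
    refine ⟨hP, ?_⟩
    change MvPolynomial.eval P _ = 0
    rw [eval_cone, sub_self, zero_dotProduct]
  refine ⟨hPC, ?_⟩
  -- Any finite system of generators will do, since the gradient statement holds for every element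
  -- of the ideal.
  obtain ⟨m, g, hg⟩ := Submodule.fg_iff_exists_fin_generating_family.1
    (IsNoetherian.noetherian (MvPolynomial.vanishingIdeal ℝ
      (TorusQuadric.intersectionCurve R r (∑ i, ∑ j, MvPolynomial.C (M i j) *
      (MvPolynomial.X i - MvPolynomial.C (P i)) * (MvPolynomial.X j - MvPolynomial.C (P j))))))
  refine ⟨m, g, hg, ?_⟩
  have hrow : ∀ l, ∃ k, ∀ i, MvPolynomial.eval P (MvPolynomial.pderiv i (g l)) =
      k * torusGradient R r P i := by
    intro l
    have hmem : g l ∈ MvPolynomial.vanishingIdeal ℝ (TorusQuadric.intersectionCurve R r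
        (∑ i, ∑ j, MvPolynomial.C (M i j) * (MvPolynomial.X i - MvPolynomial.C (P i)) *
        (MvPolynomial.X j - MvPolynomial.C (P j)))) := by
      rw [← hg]
      exact Submodule.subset_span ⟨l, rfl⟩
    have hvan := MvPolynomial.mem_vanishingIdeal_iff.1 hmem
    refine gradient_proportional_of_vanishing hr hrR hT hv hlead (hvan P hPC) fun s τ hTs => ?_
    refine hvan _ ⟨hTs, ?_⟩
    change MvPolynomial.eval _ _ = 0
    rw [eval_cone]
    have : (fun i => P i + τ * Polynomial.eval s (quadraticCurve v₀ v₁ v₂ i)) - P =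
        τ • (v₀ + s • v₁ + s ^ 2 • v₂) := by
      funext i
      simp [eval_quadraticCurve]
    rw [this, mulVec_smul, dotProduct_smul, smul_dotProduct, hiso, smul_zero, smul_zero]
  choose k hk using hrow
  have : TorusQuadric.jacobianAt g P = vecMulVec k (torusGradient R r P) := by
    ext l i
    exact hk l i
  rw [this]
  exact rank_vecMulVec_le _ _

end
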